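/- **Setting.** A weighted, pure $d$-dimensional simplicial complex $(X,\Pi)$ on $[n]$ is a family $X\subseteq\binom{[n]}{d}$ with a probability distribution $\Pi$ on $X$ that is positive on every element of $X$. For $0\le i\le d$, let $X(i)$ be the set of $i$-element subsets of members of $X$ (the $i$-faces), with the distributions $\Pi_d=\Pi$ and $\Pi_i(x)=\frac1{i+1}\sum_{y\in X(i+1),\,y\supset x}\Pi_{i+1}(y)$, and let $C_i$ be the space of functions $X(i)\to\mathbb R$ with $\langle f,g\rangle=\mathbb E_{\Pi_i}[fg]$. The link of $s\in X(i)$ is the $(d-i)$-dimensional complex $\{t\setminus s: t\in X,\ t\supseteq s\}$ with $\Pi$ normalized over these faces. $(X,\Pi)$ is a *two-sided $\gamma$-local-spectral expander* if for every $i\le d-2$ and every $s\in X(i)$, the random walk on the vertices of the link of $s$, with transition probabilities proportional to the induced weights of the $2$-faces of the link, has second largest eigenvalue in absolute value (with multiplicity) at most $\gamma$. Let $U_kf(y)=\frac1{k+1}\sum_{x\in X(k),\,x\subset y}f(x)$ and $D_{k+1}f(x)=\frac1{k+1}\sum_{y\in X(k+1),\,y\supset x}\frac{\Pi_{k+1}(y)}{\Pi_k(x)}f(y)$.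 A *$k$-dimensional pure walk* $Y$ of height $h(Y)$ is a composition $Z_{2h(Y)}\circ\cdots\circ Z_1:C_k\to C_k$ of such operators, with $h(Y)$ of them of each kind, staying within the levels $0,\dots,d$. If its down operators are $Z_{i_1},\dots,Z_{i_{h(Y)}}$ with $i_1<\dots<i_{h(Y)}$, put $$\lambda_\ell(Y)=\prod_{s=1}^{h(Y)}\Bigl(1-\frac{\ell}{\max\{\ell,\ i_s-2s+k+1\}}\Bigr).$$ A *$k$-dimensional HD-walk* on $(X,\Pi)$ is a finite formal affine combination $M=\sum_Y\alpha_YY$, $\sum_Y\alpha_Y=1$, of pure walks (as words in $U,D$) whose operator on $C_k$ is self-adjoint and has non-negative transition probabilities $M(v,y)$. Put $w(M)=\sum_Y|\alpha_Y|$, $h(M)=\max\{h(Y):\alpha_Y\ne0\}$ and $\lambda_\ell(M)=\sum_Y\alpha_Y\lambda_\ell(Y)$. $M$ is *complete* if for every $m\in\mathbb N$ there are $n_0>m$ and $d_0\le n_0$ such that the same combination is an HD-walk on the complex of all $d_0$-subsets of $[n_0]$ with the uniform distribution. For non-empty $S\subseteq X(k)$, let $\phi(S)=\mathbb E_{v\sim\Pi_k|_S}\bigl[\sum_{y\in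 X(k)\setminus S}M(v,y)\bigr]$, where $\Pi_k|_S$ is $\Pi_k$ conditioned on $S$. **Theorem.** There are absolute constants $C_1,C_2>0$ such that the following holds. Let $0\le k<d$, let $0\le\gamma\le2^{-C_1k}$, let $(X,\Pi)$ be a $d$-dimensional two-sided $\gamma$-local-spectral expander, and let $M$ be a complete $k$-dimensional HD-walk on $(X,\Pi)$. Then for every $0\le i\le k$ and every $\tau\in X(i)$, the set $X_\tau=\{\sigma\in X(k):\sigma\supseteq\tau\}$ satisfies $$\bigl|\phi(X_\tau)-(1-\lambda_i(M))\bigr|\le w(M)\,h(M)^2\,2^{C_2k}\,\gamma .$$ -/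

import Mathlib

namespace HDX

/-- A weighted, pure `d`-dimensional simplicial complex on the ground set `V`: a finite family of
top-level faces, all with exactly `d` elements (an `i`-face has `i` elements), together with a
probability distribution on the top-level faces that gives each of them positive mass. -/
structure WeightedComplex (V : Type*) (d : ℕ) where
  /-- the top-level faces -/
  faces : Finset (Finset V)
  /-- the distribution on the top-level faces (only its values on `faces` are used) -/
  weight : Finset V → ℝ
  card_eq : ∀ t ∈ faces, t.card = d
  weight_pos : ∀ t ∈ faces, 0 < weight t
  sum_weight : ∑ t ∈ faces, weight t = 1

namespace WeightedComplex

variable {V : Type*} [DecidableEq V] {d : ℕ}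

/-- `X(i)`: the `i`-element subsets of top-level faces. -/
def level (X : WeightedComplex V d) (i : ℕ) : Finset (Finset V) :=
  X.faces.biUnion fun t => t.powersetCard i

/-- The space `C_k` of real functions on the `k`-faces. -/
abbrev Cochain (X : WeightedComplex V d) (k : ℕ) : Type _ := X.level k → ℝ

/-- The total mass of the top-level faces that contain `x`. -/
def topMass (X : WeightedComplex V d) (x : Finset V) : ℝ :=
  ∑ t ∈ X.faces with x ⊆ t, X.weight t

/-- The induced distribution `Π_i` on `X(i)`, at a face `x` with `i = |x|` elements: draw a
top-level face `t` from `Π`, then a uniformly random `i`-element subset of `t`. It is the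
distribution given by downward closure, see `prob_of_mem_faces` and `prob_eq_sum`. -/
noncomputable def prob (X : WeightedComplex V d) (x : Finset V) : ℝ :=
  X.topMass x / (d.choose x.card : ℝ)

theorem mem_level {X : WeightedComplex V d} {i : ℕ} {s : Finset V} :
    s ∈ X.level i ↔ ∃ t ∈ X.faces, s ⊆ t ∧ s.card = i := by
  simp [level, Finset.mem_powersetCard]

theorem topMass_pos {X : WeightedComplex V d} {i : ℕ} {s : Finset V} (hs : s ∈ X.level i) :
    0 < X.topMass s := by
  obtain ⟨t, ht, hst, -⟩ := mem_level.1 hs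
  unfold topMass
  refine Finset.sum_pos (fun t ht => X.weight_pos t (Finset.mem_filter.1 ht).1) ⟨t, ?_⟩
  simp [ht, hst]

/-- `Π_d = Π`. -/
theorem prob_of_mem_faces (X : WeightedComplex V d) {t : Finset V} (ht : t ∈ X.faces) :
    X.prob t = X.weight t := by
  have h : {t' ∈ X.faces | t ⊆ t'} = {t} := by
    ext u
    simp only [Finset.mem_filter, Finset.mem_singleton]
    constructor
    · rintro ⟨hu, htu⟩
      exact (Finset.eq_of_subset_of_card_le htu (by rw [X.card_eq _ hu, X.card_eq _ ht])).symm
    · rintro rfl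
      exact ⟨ht, subset_rfl⟩
  simp [prob, topMass, h, X.card_eq _ ht]

/-- `Π_i(x) = (1 / (i + 1)) ∑_{y ∈ X(i+1), y ⊃ x} Π_{i+1}(y)` for `i < d`. -/
theorem prob_eq_sum (X : WeightedComplex V d) {i : ℕ} (hi : i < d) {x : Finset V}
    (hx : x ∈ X.level i) :
    X.prob x = 1 / ((i : ℝ) + 1) * ∑ y ∈ X.level (i + 1) with x ⊂ y, X.prob y := by
  obtain ⟨-, -, -, hxi⟩ := mem_level.1 hx
  have h1 : ∑ y ∈ X.level (i + 1) with x ⊂ y, X.prob y =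
      (∑ y ∈ X.level (i + 1) with x ⊂ y, X.topMass y) / (d.choose (i + 1) : ℝ) := by
    rw [Finset.sum_div]
    refine Finset.sum_congr rfl fun y hy => ?_
    obtain ⟨-, -, -, hyi⟩ := mem_level.1 (Finset.mem_filter.1 hy).1
    rw [prob, hyi]
  have h2 : ∑ y ∈ X.level (i + 1) with x ⊂ y, X.topMass y = ((d : ℝ) - i) * X.topMass x := by
    unfold topMass
    rw [Finset.sum_comm' (t' := {t ∈ X.faces | x ⊆ t})
      (s' := fun t => {y ∈ X.level (i + 1) | x ⊂ y ∧ y ⊆ t})]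
    · rw [Finset.mul_sum]
      refine Finset.sum_congr rfl fun t ht => ?_
      obtain ⟨htX, hxt⟩ := Finset.mem_filter.1 ht
      have : {y ∈ X.level (i + 1) | x ⊂ y ∧ y ⊆ t} = (t \ x).image fun v => insert v x := by
        ext y
        simp only [Finset.mem_filter, Finset.mem_image, Finset.mem_sdiff]
        constructor
        · rintro ⟨hy, hxy, hyt⟩
          obtain ⟨-, -, -, hyi⟩ := mem_level.1 hy
          obtain ⟨v, hv, hvy⟩ := Finset.ssubset_iff.1 hxy
          refine ⟨v, ⟨hyt (hvy (Finset.mem_insert_self _ _)), hv⟩, ?_⟩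
          refine Finset.eq_of_subset_of_card_le hvy ?_
          rw [Finset.card_insert_of_notMem hv, hyi, hxi]
        · rintro ⟨v, ⟨hvt, hvx⟩, rfl⟩
          have hsub : insert v x ⊆ t := Finset.insert_subset hvt hxt
          refine ⟨mem_level.2 ⟨t, htX, hsub, ?_⟩, Finset.ssubset_insert hvx, hsub⟩
          rw [Finset.card_insert_of_notMem hvx, hxi]
      rw [Finset.sum_const, this, Finset.card_image_of_injOn, Finset.card_sdiff_of_subset hxt,
        X.card_eq _ htX, hxi, nsmul_eq_mul, Nat.cast_sub hi.le]
      intro v hv w hw hvw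
      have hv' := (Finset.mem_sdiff.1 hv).2
      have : v ∈ insert w x := by
        rw [← show insert v x = insert w x from hvw]
        exact Finset.mem_insert_self _ _
      exact (Finset.mem_insert.1 this).resolve_right hv'
    · intro y t
      simp only [Finset.mem_filter]
      constructor
      · rintro ⟨⟨a, b⟩, c, e⟩
        exact ⟨⟨a, b, e⟩, c, b.subset.trans e⟩
      · rintro ⟨⟨a, b, e⟩, c, -⟩
        exact ⟨⟨a, b⟩, c, e⟩
  have h3 : (d.choose (i + 1) : ℝ) * ((i : ℝ) + 1) = d.choose i * ((d : ℝ) - i) := by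
    have := Nat.choose_succ_right_eq d i
    rw [← Nat.cast_sub hi.le]
    exact_mod_cast this
  have h4 : (0 : ℝ) < d.choose i := by exact_mod_cast Nat.choose_pos hi.le
  have h5 : (0 : ℝ) < d.choose (i + 1) := by exact_mod_cast Nat.choose_pos hi
  rw [h1, h2, prob, hxi]
  field_simp
  linear_combination X.topMass x * h3

/-- The link `X_s` of an `i`-face `s`: its top-level faces are the sets `t \ s`, for `t` a
top-level face of `X` that contains `s`, with the distribution `Π` normalized over these. -/
noncomputable def link (X : WeightedComplex V d) {i : ℕ} (s : Finset V) (hs : s ∈ X.level i) :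
    WeightedComplex V (d - i) where
  faces := {t ∈ X.faces | s ⊆ t}.image fun t => t \ s
  weight t := X.weight (t ∪ s) / X.topMass s
  card_eq := by
    obtain ⟨-, -, -, hsi⟩ := mem_level.1 hs
    intro t ht
    simp only [Finset.mem_image, Finset.mem_filter] at ht
    obtain ⟨t, ⟨ht, hst⟩, rfl⟩ := ht
    rw [Finset.card_sdiff_of_subset hst, X.card_eq _ ht, hsi]
  weight_pos := by
    intro t ht
    simp only [Finset.mem_image, Finset.mem_filter] at ht
    obtain ⟨t, ⟨ht, hst⟩, rfl⟩ := ht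
    rw [Finset.sdiff_union_of_subset hst]
    exact div_pos (X.weight_pos _ ht) (topMass_pos hs)
  sum_weight := by
    rw [Finset.sum_image, ← Finset.sum_div]
    · have h : ∑ t ∈ X.faces with s ⊆ t, X.weight (t \ s ∪ s) = X.topMass s :=
        Finset.sum_congr rfl fun t ht => by
          rw [Finset.sdiff_union_of_subset (Finset.mem_filter.1 ht).2]
      rw [h, div_self (topMass_pos hs).ne']
    · intro t ht u hu htu
      have ht' := (Finset.mem_filter.1 ht).2
      have hu' := (Finset.mem_filter.1 hu).2
      rw [← Finset.sdiff_union_of_subset ht', ← Finset.sdiff_union_of_subset hu']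
      exact congrArg (· ∪ s) htu

/-- The edge weights of the underlying graph `(X(1), X(2))`: the weight of the edge `{u, v}` is
`Π_2({u, v})` (which is `0` if `{u, v}` is not a `2`-face). Vertices are the singletons in `X(1)`. -/
noncomputable def edgeWeight (X : WeightedComplex V d) (u v : X.level 1) : ℝ :=
  if u = v then 0 else X.prob ((u : Finset V) ∪ (v : Finset V))

/-- The sum of the weights of the edges at the vertex `u`. -/
noncomputable def vertexDegree (X : WeightedComplex V d) (u : X.level 1) : ℝ :=
  ∑ v, X.edgeWeight u v

/-- The vertex-edge-vertex random walk on the underlying graph, with transition probabilities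
proportional to the edge weights, acting on functions on the vertices. -/
noncomputable def graphWalk (X : WeightedComplex V d) (f : X.Cochain 1) : X.Cochain 1 :=
  fun u => ∑ v, X.edgeWeight u v / X.vertexDegree u * f v

/-- The underlying graph is a two-sided `γ`-spectral expander: the second largest eigenvalue in
absolute value of its random walk is at most `γ`. The walk is self-adjoint for the stationary
measure `vertexDegree`, with constant top eigenvector; its other eigenvalues, with multiplicity,
are those with an eigenvector orthogonal to the constants. -/
def IsSpectralExpander (X : WeightedComplex V d) (γ : ℝ) : Prop :=
  ∀ (μ : ℝ) (f : X.Cochain 1), f ≠ 0 → ∑ u, X.vertexDegree u * f u = 0 →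
    X.graphWalk f = μ • f → |μ| ≤ γ

/-- A two-sided `γ`-local-spectral expander: for every `i ≤ d - 2` and every `i`-face `s`, the
underlying graph of the link of `s` is a two-sided `γ`-spectral expander. -/
def IsLocalSpectralExpander (X : WeightedComplex V d) (γ : ℝ) : Prop :=
  ∀ (i : ℕ), i + 2 ≤ d → ∀ (s : Finset V) (hs : s ∈ X.level i),
    (X.link s hs).IsSpectralExpander γ

/-- The up operator `U_k : C_k → C_{k+1}`. -/
noncomputable def up (X : WeightedComplex V d) (k : ℕ) : X.Cochain k →ₗ[ℝ] X.Cochain (k + 1) where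
  toFun f y := 1 / ((k : ℝ) + 1) * ∑ x ∈ (Finset.univ : Finset (X.level k)) with x.1 ⊂ y.1, f x
  map_add' f g := by
    funext y
    simp only [Pi.add_apply, Finset.sum_add_distrib, mul_add]
  map_smul' c f := by
    funext y
    simp only [Pi.smul_apply, smul_eq_mul, RingHom.id_apply, ← Finset.mul_sum]
    ring

/-- The down operator `D_{k+1} : C_{k+1} → C_k`. -/
noncomputable def down (X : WeightedComplex V d) (k : ℕ) :
    X.Cochain (k + 1) →ₗ[ℝ] X.Cochain k where
  toFun f x := 1 / ((k : ℝ) + 1) *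
    ∑ y ∈ (Finset.univ : Finset (X.level (k + 1))) with x.1 ⊂ y.1, X.prob y.1 / X.prob x.1 * f y
  map_add' f g := by
    funext x
    simp only [Pi.add_apply, mul_add, Finset.sum_add_distrib]
  map_smul' c f := by
    funext x
    simp only [Pi.smul_apply, smul_eq_mul, RingHom.id_apply, Finset.mul_sum]
    exact Finset.sum_congr rfl fun y _ => by ring

/-- The inner product `⟨f, g⟩ = 𝔼_{Π_k}[f g]` on `C_k`. -/
noncomputable def innerProd (X : WeightedComplex V d) {k : ℕ} (f g : X.Cochain k) : ℝ :=
  ∑ x : X.level k, X.prob x.1 * (f x * g x)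

/-- The `k`-faces that contain `τ` (the link of `τ`, as a set of `k`-faces). -/
def linkFaces (X : WeightedComplex V d) (k : ℕ) (τ : Finset V) : Finset (X.level k) :=
  {s ∈ (Finset.univ : Finset (X.level k)) | τ ⊆ s.1}

/-- The transition probability `M(v, y)` of an operator `M` on `C_k`: its matrix entry. -/
def transition (X : WeightedComplex V d) {k : ℕ} (M : X.Cochain k →ₗ[ℝ] X.Cochain k)
    (v y : X.level k) : ℝ :=
  M (Pi.single y 1) v

/-- The weighted edge expansion `φ(S) = 𝔼_{v ∼ Π_k|_S} [M(v, X(k) \ S)]`. -/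
noncomputable def expansion (X : WeightedComplex V d) {k : ℕ}
    (M : X.Cochain k →ₗ[ℝ] X.Cochain k) (S : Finset (X.level k)) : ℝ :=
  (∑ v ∈ S, X.prob v * ∑ y ∈ Sᶜ, X.transition M v y) / ∑ v ∈ S, X.prob v

end WeightedComplex

/-- The complete complex `J(n, d)`: all `d`-subsets of `[n]` with the uniform distribution. -/
noncomputable def completeComplex (n d : ℕ) (h : d ≤ n) : WeightedComplex (Fin n) d where
  faces := (Finset.univ : Finset (Fin n)).powersetCard d
  weight _ := 1 / (n.choose d : ℝ)
  card_eq _ ht := (Finset.mem_powersetCard.1 ht).2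
  weight_pos _ _ := by
    have : (0 : ℝ) < n.choose d := by exact_mod_cast Nat.choose_pos h
    positivity
  sum_weight := by
    have : (n.choose d : ℝ) ≠ 0 := by exact_mod_cast (Nat.choose_pos h).ne'
    simp [this]

/-- Words in the letters `U` and `D` that lead from level `a` to level `b`. The letter that is
added last is the operator that is applied last; `D` can only be applied at a level `≥ 1`. A pure
walk on `k`-faces is a word in `UDWord k k`; it has as many `D` as `U`. -/
inductive UDWord (a : ℕ) : ℕ → Type
  | nil : UDWord a a
  | up {b : ℕ} (w : UDWord a b) : UDWord a (b + 1)
  | down {b : ℕ} (w : UDWord a (b + 1)) : UDWord a b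

namespace UDWord

variable {a b : ℕ}

/-- The highest level that the walk visits. -/
def top {a : ℕ} : {b : ℕ} → UDWord a b → ℕ
  | _, nil => a
  | _, @up _ b w => max w.top (b + 1)
  | _, down w => w.top

/-- The number of down operators; for `w : UDWord k k` this is the height `h(w)`. -/
def height {a : ℕ} : {b : ℕ} → UDWord a b → ℕ
  | _, nil => 0
  | _, up w => w.height
  | _, down w => w.height + 1

/-- The approximate eigenvalue `λ_ℓ(Y) = ∏_s (1 - ℓ / max {ℓ, i_s - 2 s + k + 1})` of a pure walk
`Y` on `k`-faces whose `s`-th down operator is its `i_s`-th operator: `i_s - 2 s + k + 1` is the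
level from which that down operator leads to the level below. -/
noncomputable def approxEigenvalue {a : ℕ} (l : ℕ) : {b : ℕ} → UDWord a b → ℝ
  | _, nil => 1
  | _, up w => w.approxEigenvalue l
  | _, @down _ b w => w.approxEigenvalue l * (1 - (l : ℝ) / (max l (b + 1) : ℕ))

/-- The composition of up and down operators that the word describes. -/
noncomputable def operator {V : Type*} [DecidableEq V] {d a : ℕ} (X : WeightedComplex V d) :
    {b : ℕ} → UDWord a b → (X.Cochain a →ₗ[ℝ] X.Cochain b)
  | _, nil => LinearMap.id
  | _, @up _ b w => X.up b ∘ₗ w.operator X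
  | _, @down _ b w => X.down b ∘ₗ w.operator X

end UDWord

/-- A formal linear combination `∑ α_Y Y` of pure walks on `k`-faces. -/
abbrev WalkCombination (k : ℕ) : Type := UDWord k k →₀ ℝ

namespace WalkCombination

variable {k : ℕ}

/-- The height `h(M)`: the maximal height of a pure walk with non-zero coefficient. -/
def height (M : WalkCombination k) : ℕ := M.support.sup UDWord.height

/-- The weight `w(M) = ∑ |α_Y|`. -/
noncomputable def weight (M : WalkCombination k) : ℝ := M.sum fun _ α => |α|

/-- The approximate eigenvalue `λ_ℓ(M) = ∑ α_Y λ_ℓ(Y)`. -/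
noncomputable def approxEigenvalue (M : WalkCombination k) (l : ℕ) : ℝ :=
  M.sum fun Y α => α * Y.approxEigenvalue l

/-- The operator on `C_k` that the combination defines on a weighted complex. -/
noncomputable def operator {V : Type*} [DecidableEq V] {d : ℕ} (M : WalkCombination k)
    (X : WeightedComplex V d) : X.Cochain k →ₗ[ℝ] X.Cochain k :=
  M.sum fun Y α => α • Y.operator X

/-- `M` is a `k`-dimensional HD-walk on `X`: an affine combination of pure walks that stay within
the levels `0, …, d` of the complex, which is self-adjoint and has non-negative transition
probabilities. -/
structure IsHDWalk {V : Type*} [DecidableEq V] {d : ℕ} (M : WalkCombination k)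
    (X : WeightedComplex V d) : Prop where
  top_le : ∀ Y ∈ M.support, Y.top ≤ d
  affine : (M.sum fun _ α => α) = 1
  selfAdjoint : ∀ f g : X.Cochain k,
    X.innerProd (M.operator X f) g = X.innerProd f (M.operator X g)
  nonneg : ∀ v y : X.level k, 0 ≤ X.transition (M.operator X) v y

/-- `M` is complete: for all `n` there are `n₀ > n` and `d₀` such that the same combination is an
HD-walk on the complete complex `J(n₀, d₀)`. -/
def IsComplete (M : WalkCombination k) : Prop :=
  ∀ n : ℕ, ∃ (n₀ d₀ : ℕ) (h : d₀ ≤ n₀), n < n₀ ∧ M.IsHDWalk (completeComplex n₀ d₀ h)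

end WalkCombination

end HDX

/-! Write `1_τ` for the indicator, on any level, of the faces that contain `τ`, and let `ℓ` be the
number of elements of `τ`. An HD-walk fixes constants, so the expansion is `1 - ⟨M 1_τ, 1_τ⟩ / ⟨1_τ,
1_τ⟩` (`expansion_linkFaces`), and by linearity a single pure walk has to be understood. An up
operator maps `1_τ` exactly to a multiple of `1_τ` one level higher (`up_starIndicator`). A down
operator maps it to `1_τ` plus a defect (`starDefect`) supported off the star of `τ`. If the defects
are ignored, the factors along the walk multiply to `λ_ℓ`.

Local expansion makes defects small: the squared norm is at most `ε = ℓ (γ + γ²)` times that of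
`1_τ` one level higher (`innerProd_starDefect_le`). Below the top, a nonzero value of the defect at
`x` is the probability of a vertex in the link of `x`, and a vertex of a loopless expander has
probability at most `γ`. In the last step below the top the link of `x` has no edges; there the
links of codimension two serve, in which a two-step walk returns with probability at most `γ + γ²`.

Norm bounds alone would give an error of order `√γ`. The linear bound comes from orthogonality: a
defect is orthogonal to `1_τ`, so it contributes only when paired with another error. Letters are
peeled off the end of the word and moved by adjointness to the test function, which stays near a
multiple of `1_τ`. With `G = ⟨1_τ, 1_τ⟩` on level `k`, each up letter moved this way adds at most
`√(ε G)` to the deviation, and each down letter pairs a defect of norm at most `√(ε G)` with that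
deviation. This gives at most `h²` pairs of size `ε G` (`exists_abs_innerProd_operator_sub_le`). -/

namespace HDX

/-! ### Spectral bounds for a weighted graph. -/

/-- A symmetric operator all of whose eigenvalues are at most `γ` in absolute value contracts
by `γ`. -/
theorem norm_sq_le_of_eigenvalue_le {E : Type*} [NormedAddCommGroup E] [InnerProductSpace ℝ E]
    [FiniteDimensional ℝ E] {T : E →ₗ[ℝ] E} (hT : T.IsSymmetric) {γ : ℝ}
    (h : ∀ (μ : ℝ) (x : E), x ≠ 0 → T x = μ • x → |μ| ≤ γ) (x : E) :
    ‖T x‖ ^ 2 ≤ γ ^ 2 * ‖x‖ ^ 2 := by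
  let b := hT.eigenvectorBasis rfl
  rw [← b.sum_sq_norm_inner_right (T x), ← b.sum_sq_norm_inner_right x, Finset.mul_sum]
  refine Finset.sum_le_sum fun j _ => ?_
  have hj : T (b j) = hT.eigenvalues rfl j • b j := hT.apply_eigenvectorBasis rfl j
  have hle := h _ (b j) (b.orthonormal.ne_zero j) hj
  rw [← hT (b j) x, hj, real_inner_smul_left, norm_mul, mul_pow]
  refine mul_le_mul_of_nonneg_right ?_ (sq_nonneg _)
  exact pow_le_pow_left₀ (norm_nonneg _) hle 2

/-- In a weighted graph without loops whose random walk has all its nontrivial eigenvalues bounded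
by `γ`, every vertex has small stationary measure, and a walk of two steps returns with
small probability. -/
theorem degree_le_and_sum_sq_div_degree_le {ι : Type*} [Fintype ι] [DecidableEq ι]
    (w : ι → ι → ℝ) (δ : ι → ℝ) (hw : ∀ u v, w u v = w v u) (hloop : ∀ u, w u u = 0)
    (hδ : ∀ u, δ u = ∑ v, w u v) (hpos : ∀ u, 0 < δ u) {γ : ℝ} (hγ : 0 ≤ γ)
    (h : ∀ (μ : ℝ) (f : ι → ℝ), f ≠ 0 → ∑ u, δ u * f u = 0 →
      (fun u => ∑ v, w u v / δ u * f v) = μ • f → |μ| ≤ γ) (v : ι) :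
    δ v ≤ γ * ∑ u, δ u ∧ ∑ u, w u v ^ 2 / δ u ≤ (γ + γ ^ 2) * δ v := by
  set S := ∑ u, δ u with hS
  have hSpos : 0 < S := Finset.sum_pos (fun u _ => hpos u) ⟨v, Finset.mem_univ v⟩
  set q : ι → ℝ := fun u => √(δ u) with hq
  have hqpos : ∀ u, 0 < q u := fun u => Real.sqrt_pos.2 (hpos u)
  have hqq : ∀ u, q u * q u = δ u := fun u => Real.mul_self_sqrt (hpos u).le
  -- The walk, symmetrised by the square roots of the degrees, minus the projection onto its top
  -- eigenvector `q`.
  let B : Matrix ι ι ℝ := fun a b => w a b / (q a * q b) - q a * q b / S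
  have hBsymm : B.IsHermitian := by
    ext a b
    rw [Matrix.conjTranspose_apply, star_trivial]
    simp only [B, hw b a, mul_comm (q b)]
  have hsym := Matrix.isSymmetric_toEuclideanLin_iff.2 hBsymm
  have happ : ∀ (f : EuclideanSpace ℝ ι) a,
      (B.toEuclideanLin f) a = ∑ b, B a b * f b := fun f a => by
    simp [Matrix.toLpLin_apply, Matrix.mulVec, dotProduct]
  have hBq : ∀ a, ∑ b, B a b * q b = 0 := by
    intro a
    have : ∀ b, B a b * q b = w a b / q a - q a / S * δ b := by
      intro b
      have h1 := (hqpos a).ne'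
      have h2 := (hqpos b).ne'
      simp only [B, ← hqq b]
      field_simp
    rw [Finset.sum_congr rfl fun b _ => this b, Finset.sum_sub_distrib, ← Finset.sum_div,
      ← hδ, ← Finset.mul_sum, ← hS, ← hqq a]
    have h1 := (hqpos a).ne'
    field_simp
    ring
  have hnorm := norm_sq_le_of_eigenvalue_le hsym (γ := γ) (by
    intro μ f hf hμ
    rcases eq_or_ne μ 0 with rfl | hμ0
    · simpa using hγ
    have hμ' : ∀ a, ∑ b, B a b * f b = μ * f a := fun a => by
      rw [← happ, hμ]; simp
    -- Since `B` is symmetric and kills `q`, an eigenvector with `μ ≠ 0` is orthogonal to `q`;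
    -- divided by `q`, it is an eigenvector of the walk orthogonal to the constants.
    have horth : ∑ a, q a * f a = 0 := by
      have h1 : μ * ∑ a, q a * f a = 0 := by
        have : ∀ a, μ * (q a * f a) = ∑ b, B b a * q a * f b := fun a => by
          rw [mul_left_comm, ← hμ' a, Finset.mul_sum]
          refine Finset.sum_congr rfl fun b _ => ?_
          rw [← hBsymm.apply a b, star_trivial]
          ring
        rw [Finset.mul_sum, Finset.sum_congr rfl fun a _ => this a, Finset.sum_comm]
        refine Finset.sum_eq_zero fun b _ => ?_
        rw [← Finset.sum_mul, hBq, zero_mul]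
      exact (mul_eq_zero.1 h1).resolve_left hμ0
    refine h μ (fun a => f a / q a) ?_ ?_ ?_
    · intro h0
      apply hf
      ext a
      have := congrFun h0 a
      simpa [(hqpos a).ne'] using this
    · rw [← horth]
      refine Finset.sum_congr rfl fun a _ => ?_
      have := (hqpos a).ne'
      rw [← hqq a]
      field_simp
    · funext a
      have h1 := (hqpos a).ne'
      have h2 : ∑ b, w a b / (q a * q b) * f b = μ * f a := by
        rw [← hμ' a, ← sub_eq_zero, ← Finset.sum_sub_distrib]
        have : ∀ b, w a b / (q a * q b) * f b - B a b * f b = q a / S * (q b * f b) := fun b => by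
          simp only [B]; ring
        rw [Finset.sum_congr rfl fun b _ => this b, ← Finset.mul_sum, horth, mul_zero]
      simp only [Pi.smul_apply, smul_eq_mul]
      rw [← mul_div_assoc, ← h2, Finset.sum_div]
      refine Finset.sum_congr rfl fun b _ => ?_
      have h3 := (hqpos b).ne'
      rw [← hqq a]
      field_simp) (EuclideanSpace.single v 1)
  -- The column of `v` carries both bounds: its diagonal entry is `-δ v / S` for lack of loops, and
  -- its squared norm is the two-step return probability minus `δ v / S`.
  have hcol : ∑ a, B a v ^ 2 ≤ γ ^ 2 := by
    have h1 : ∀ a, (B.toEuclideanLin (EuclideanSpace.single v 1)) a = B a v := fun a => by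
      rw [happ]; simp
    rw [EuclideanSpace.norm_sq_eq] at hnorm
    simpa [h1] using hnorm
  have hdiag : δ v / S ≤ γ := by
    have h1 : B v v ^ 2 ≤ γ ^ 2 :=
      (Finset.single_le_sum (f := fun a => B a v ^ 2) (fun a _ => sq_nonneg _)
        (Finset.mem_univ v)).trans hcol
    have h2 : B v v = - (δ v / S) := by simp [B, hloop, hqq]
    rw [h2, neg_sq] at h1
    exact (le_abs_self _).trans (sq_le_sq₀ (abs_nonneg _) hγ |>.1 (by rwa [sq_abs]))
  refine ⟨(div_le_iff₀ hSpos).1 hdiag, ?_⟩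
  have h1 : ∑ a, B a v ^ 2 = (∑ u, w u v ^ 2 / δ u) / δ v - δ v / S := by
    have : ∀ a, B a v ^ 2 = w a v ^ 2 / δ a / δ v - 2 / S * w v a + δ v / S ^ 2 * δ a := by
      intro a
      have h1 := (hqpos a).ne'
      have h2 := (hqpos v).ne'
      rw [hw v a]
      simp only [B, ← hqq]
      field_simp
      ring
    rw [Finset.sum_congr rfl fun a _ => this a, Finset.sum_add_distrib,
      Finset.sum_sub_distrib, ← Finset.mul_sum, ← Finset.mul_sum, ← hδ, ← hS, ← Finset.sum_div]
    field_simp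
    ring
  rw [h1] at hcol
  rw [← div_le_iff₀ (hpos v)]
  linarith

end HDX

namespace HDX

namespace WeightedComplex

variable {V : Type*} [DecidableEq V] {d : ℕ}

/-! ### Faces and their masses. -/

theorem card_of_mem_level {X : WeightedComplex V d} {i : ℕ} {s : Finset V} (hs : s ∈ X.level i) :
    s.card = i := by
  obtain ⟨-, -, -, h⟩ := mem_level.1 hs
  exact h

theorem le_of_mem_level {X : WeightedComplex V d} {i : ℕ} {s : Finset V} (hs : s ∈ X.level i) :
    i ≤ d := by
  obtain ⟨t, ht, hst, h⟩ := mem_level.1 hs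
  rw [← h, ← X.card_eq t ht]
  exact Finset.card_le_card hst

theorem mem_level_of_subset {X : WeightedComplex V d} {i : ℕ} {s t : Finset V}
    (ht : t ∈ X.level i) (hst : s ⊆ t) : s ∈ X.level s.card := by
  obtain ⟨u, hu, htu, -⟩ := mem_level.1 ht
  exact mem_level.2 ⟨u, hu, hst.trans htu, rfl⟩

theorem topMass_nonneg (X : WeightedComplex V d) (s : Finset V) : 0 ≤ X.topMass s :=
  Finset.sum_nonneg fun t ht => (X.weight_pos t (Finset.mem_filter.1 ht).1).le

theorem topMass_anti (X : WeightedComplex V d) {s t : Finset V} (h : s ⊆ t) :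
    X.topMass t ≤ X.topMass s := by
  refine Finset.sum_le_sum_of_subset_of_nonneg ?_
    fun u hu _ => (X.weight_pos u (Finset.mem_filter.1 hu).1).le
  intro u hu
  obtain ⟨hu, htu⟩ := Finset.mem_filter.1 hu
  exact Finset.mem_filter.2 ⟨hu, h.trans htu⟩

theorem topMass_eq_zero {X : WeightedComplex V d} {s : Finset V} (hs : s ∉ X.level s.card) :
    X.topMass s = 0 := by
  refine Finset.sum_eq_zero fun t ht => absurd ?_ hs
  obtain ⟨ht, hst⟩ := Finset.mem_filter.1 ht
  exact mem_level.2 ⟨t, ht, hst, rfl⟩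

theorem prob_nonneg (X : WeightedComplex V d) (s : Finset V) : 0 ≤ X.prob s :=
  div_nonneg (X.topMass_nonneg s) (Nat.cast_nonneg _)

theorem prob_eq_zero {X : WeightedComplex V d} {s : Finset V} (hs : s ∉ X.level s.card) :
    X.prob s = 0 := by
  rw [prob, topMass_eq_zero hs, zero_div]

theorem prob_of_mem_level {X : WeightedComplex V d} {i : ℕ} {s : Finset V} (hs : s ∈ X.level i) :
    X.prob s = X.topMass s / (d.choose i : ℝ) := by
  rw [prob, card_of_mem_level hs]

theorem prob_pos {X : WeightedComplex V d} {i : ℕ} {s : Finset V} (hs : s ∈ X.level i) :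
    0 < X.prob s := by
  rw [prob_of_mem_level hs]
  exact div_pos (topMass_pos hs) (by exact_mod_cast Nat.choose_pos (le_of_mem_level hs))

theorem choose_succ_mul {i : ℕ} (hi : i < d) :
    (d.choose (i + 1) : ℝ) * ((i : ℝ) + 1) = d.choose i * ((d : ℝ) - i) := by
  have := Nat.choose_succ_right_eq d i
  rw [← Nat.cast_sub hi.le]
  exact_mod_cast this

/-- Top masses carry no binomial normalization, so in these terms the weights of the down operator
are easy to compare with probabilities in links. -/
theorem prob_div_prob {X : WeightedComplex V d} {i : ℕ} {x y : Finset V}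
    (hx : x ∈ X.level i) (hy : y ∈ X.level (i + 1)) :
    1 / ((i : ℝ) + 1) * (X.prob y / X.prob x) = X.topMass y / (((d : ℝ) - i) * X.topMass x) := by
  have hi : i < d := le_of_mem_level hy
  have h3 := choose_succ_mul hi
  have h4 : (0 : ℝ) < d.choose i := by exact_mod_cast Nat.choose_pos hi.le
  have h5 : (0 : ℝ) < d.choose (i + 1) := by exact_mod_cast Nat.choose_pos hi
  have h6 : (0 : ℝ) < (d : ℝ) - i := sub_pos.2 (by exact_mod_cast hi)
  have h7 := topMass_pos hx
  rw [prob_of_mem_level hx, prob_of_mem_level hy]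
  field_simp
  linear_combination -X.topMass y * h3

/-- The vertices of the complex are the singletons, and `Π_1` sums to one. -/
theorem sum_prob_level_one (X : WeightedComplex V d) (hd : 0 < d) :
    ∑ u ∈ X.level 1, X.prob u = 1 := by
  have hne : X.faces.Nonempty := by
    rw [Finset.nonempty_iff_ne_empty]
    intro h
    simpa [h] using X.sum_weight
  obtain ⟨t, ht⟩ := hne
  have h0 : (∅ : Finset V) ∈ X.level 0 := mem_level.2 ⟨t, ht, by simp, by simp⟩
  have h := X.prob_eq_sum hd h0
  rw [prob_of_mem_level h0] at h
  have h1 : X.topMass ∅ = 1 := by simp [topMass, X.sum_weight]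
  have h2 : {y ∈ X.level (0 + 1) | ∅ ⊂ y} = X.level 1 := by
    refine Finset.filter_true_of_mem fun y hy => ?_
    rw [Finset.empty_ssubset, ← Finset.card_pos, card_of_mem_level hy]
    exact Nat.one_pos
  rw [h1, h2] at h
  simpa using h.symm

/-- Removing `u` matches the 2-faces above `u` with its neighbours, so the degree is the sum in
`prob_eq_sum`, and the 2 undoes the factor there. -/
theorem vertexDegree_eq (X : WeightedComplex V d) (hd : 1 < d) (u : X.level 1) :
    X.vertexDegree u = 2 * X.prob u.1 := by
  have hu := card_of_mem_level u.2
  have h1 : X.vertexDegree u = ∑ v ∈ X.level 1, if u.1 = v then 0 else X.prob (u.1 ∪ v) := by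
    rw [← Finset.sum_coe_sort]
    refine Finset.sum_congr rfl fun v _ => ?_
    simp only [edgeWeight, Subtype.ext_iff]
  have h2 : ∑ y ∈ X.level (1 + 1) with u.1 ⊂ y, X.prob y = X.vertexDegree u := by
    rw [h1]
    refine Finset.sum_of_injOn (fun y => y \ u.1) ?_ ?_ ?_ ?_
    · intro y hy z hz hyz
      have hy' := (Finset.mem_filter.1 hy).2.subset
      have hz' := (Finset.mem_filter.1 hz).2.subset
      rw [← Finset.sdiff_union_of_subset hy', ← Finset.sdiff_union_of_subset hz']
      exact congrArg (· ∪ u.1) hyz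
    · intro y hy
      obtain ⟨hy, huy⟩ := Finset.mem_filter.1 hy
      have h := mem_level_of_subset hy (Finset.sdiff_subset (s := y) (t := u.1))
      rwa [Finset.card_sdiff_of_subset huy.subset, card_of_mem_level hy, hu] at h
    · intro v hv hvy
      split_ifs with huv
      · rfl
      refine prob_eq_zero fun h => hvy ?_
      have hv' := card_of_mem_level hv
      obtain ⟨a, ha⟩ := Finset.card_eq_one.1 hu
      obtain ⟨b, rfl⟩ := Finset.card_eq_one.1 hv'
      have hdisj : Disjoint {b} u.1 := by
        rw [ha, Finset.disjoint_singleton]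
        rintro rfl
        exact huv ha
      have hc : (u.1 ∪ {b}).card = 1 + 1 := by
        rw [Finset.card_union_of_disjoint hdisj.symm, hu, hv']
      refine ⟨u.1 ∪ {b}, Finset.mem_coe.2 (Finset.mem_filter.2 ⟨hc ▸ h, ?_⟩), ?_⟩
      · refine Finset.ssubset_iff_subset_ne.2 ⟨Finset.subset_union_left, fun he => ?_⟩
        rw [← he, hu] at hc
        omega
      · simp only [Finset.union_sdiff_left]
        exact Finset.sdiff_eq_self_of_disjoint hdisj
    · intro y hy
      obtain ⟨hy, huy⟩ := Finset.mem_filter.1 hy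
      rw [if_neg, Finset.union_sdiff_of_subset huy.subset]
      intro he
      have hdisj : Disjoint (y \ u.1) u.1 := Finset.sdiff_disjoint
      rw [← he, disjoint_self, Finset.bot_eq_empty] at hdisj
      simp [hdisj] at hu
  have h3 := X.prob_eq_sum hd u.2
  rw [h2] at h3
  rw [h3]
  push_cast
  ring

/-! ### Expansion of links as bounds on masses. -/

theorem IsSpectralExpander.prob_le_and_sum_sq_le {X : WeightedComplex V d} {γ : ℝ}
    (h : X.IsSpectralExpander γ) (hγ : 0 ≤ γ) (hd : 1 < d) {v : Finset V} (hv : v ∈ X.level 1) :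
    X.prob v ≤ γ ∧ ∑ u ∈ X.level 1 with u ≠ v, X.prob (u ∪ v) ^ 2 / (2 * X.prob u) ≤
      (γ + γ ^ 2) * (2 * X.prob v) := by
  have key := degree_le_and_sum_sq_div_degree_le X.edgeWeight X.vertexDegree
    (fun u v => by simp only [edgeWeight, eq_comm, Finset.union_comm])
    (fun u => by simp [edgeWeight]) (fun u => rfl)
    (fun u => by rw [X.vertexDegree_eq hd]; exact mul_pos two_pos (prob_pos u.2)) hγ h ⟨v, hv⟩
  simp only [X.vertexDegree_eq hd] at key
  rw [← Finset.mul_sum, Finset.sum_coe_sort (X.level 1) X.prob,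
    X.sum_prob_level_one (by omega)] at key
  refine ⟨by linarith [key.1], ?_⟩
  refine le_trans (le_of_eq ?_) key.2
  rw [Finset.sum_filter, ← Finset.sum_coe_sort]
  refine Finset.sum_congr rfl fun u _ => ?_
  simp only [edgeWeight, Subtype.ext_iff]
  split_ifs with h1 h2 <;> simp_all

theorem topMass_link (X : WeightedComplex V d) {i : ℕ} {s : Finset V} (hs : s ∈ X.level i)
    {u : Finset V} (hu : Disjoint u s) :
    (X.link s hs).topMass u = X.topMass (u ∪ s) / X.topMass s := by
  have hinj : Set.InjOn (fun t => t \ s) {t : Finset V | s ⊆ t} := by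
    intro t ht u hu htu
    rw [← Finset.sdiff_union_of_subset ht, ← Finset.sdiff_union_of_subset hu]
    exact congrArg (· ∪ s) htu
  simp only [topMass, link]
  rw [Finset.sum_filter, Finset.sum_image, ← Finset.sum_filter, Finset.filter_filter,
    Finset.sum_div]
  · refine Finset.sum_congr (Finset.filter_congr fun t _ => ?_) fun t ht => ?_
    · rw [Finset.subset_sdiff, Finset.union_subset_iff]
      tauto
    · rw [Finset.sdiff_union_of_subset
        (Finset.subset_union_right.trans (Finset.mem_filter.1 ht).2)]
  · exact fun t ht u hu => hinj (Finset.mem_filter.1 ht).2 (Finset.mem_filter.1 hu).2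

theorem mem_level_link {X : WeightedComplex V d} {i j : ℕ} {s : Finset V} (hs : s ∈ X.level i)
    {u : Finset V} :
    u ∈ (X.link s hs).level j ↔ Disjoint u s ∧ u ∪ s ∈ X.level (j + i) := by
  have hsi := card_of_mem_level hs
  simp only [mem_level, link, Finset.mem_image, Finset.mem_filter]
  constructor
  · rintro ⟨-, ⟨t, ⟨ht, hst⟩, rfl⟩, hut, hu⟩
    obtain ⟨hut, hus⟩ := Finset.subset_sdiff.1 hut
    exact ⟨hus, t, ht, Finset.union_subset hut hst,
      by rw [Finset.card_union_of_disjoint hus, hu, hsi]⟩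
  · rintro ⟨hus, t, ht, hut, hu⟩
    obtain ⟨hut, hst⟩ := Finset.union_subset_iff.1 hut
    refine ⟨_, ⟨t, ⟨ht, hst⟩, rfl⟩, Finset.subset_sdiff.2 ⟨hut, hus⟩, ?_⟩
    rw [Finset.card_union_of_disjoint hus, hsi] at hu
    omega

theorem prob_link (X : WeightedComplex V d) {i j : ℕ} {s : Finset V} (hs : s ∈ X.level i)
    {u : Finset V} (hu : Disjoint u s) (hj : u.card = j) :
    (X.link s hs).prob u = X.topMass (u ∪ s) / X.topMass s / ((d - i).choose j : ℝ) := by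
  rw [prob, X.topMass_link hs hu, hj]

/-- If `insert v s` is a face, the ratio of the two masses with the factor `d - i` is the
probability of the vertex `v` in the link of `s`. -/
theorem IsLocalSpectralExpander.topMass_insert_le {X : WeightedComplex V d} {γ : ℝ}
    (h : X.IsLocalSpectralExpander γ) (hγ : 0 ≤ γ) {i : ℕ} (hi : i + 2 ≤ d) {s : Finset V}
    (hs : s ∈ X.level i) {v : V} (hv : v ∉ s) :
    X.topMass (insert v s) ≤ γ * (((d : ℝ) - i) * X.topMass s) := by
  have hi' : (0 : ℝ) < (d : ℝ) - i := sub_pos.2 (by exact_mod_cast (by omega : i < d))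
  have hpos := mul_pos hi' (topMass_pos hs)
  by_cases hvs : insert v s ∈ X.level (insert v s).card
  · rw [Finset.card_insert_of_notMem hv, card_of_mem_level hs, add_comm] at hvs
    have hdisj : Disjoint {v} s := Finset.disjoint_singleton_left.2 hv
    have hmem : {v} ∈ (X.link s hs).level 1 := (mem_level_link hs).2 ⟨hdisj, hvs⟩
    have key := ((h i hi s hs).prob_le_and_sum_sq_le hγ (by omega) hmem).1
    rw [X.prob_link hs hdisj (Finset.card_singleton v), Nat.choose_one_right,
      Nat.cast_sub (by omega), div_div, mul_comm (X.topMass s), div_le_iff₀ hpos] at key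
    exact key
  · rw [topMass_eq_zero hvs]
    positivity

/-- The link of `s` is a graph whose edges are its top faces. After normalization the sum is the
two-step return to `v`, with the midpoints `x \ s`. -/
theorem IsLocalSpectralExpander.sum_sq_topMass_insert_le {X : WeightedComplex V d} {γ : ℝ}
    (h : X.IsLocalSpectralExpander γ) (hγ : 0 ≤ γ) {i : ℕ} (hi : i + 2 = d) {s : Finset V}
    (hs : s ∈ X.level i) {v : V} (hv : v ∉ s) :
    ∑ x ∈ X.level (i + 1) with s ⊂ x ∧ v ∉ x, X.topMass (insert v x) ^ 2 / X.topMass x ≤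
      (γ + γ ^ 2) * X.topMass (insert v s) := by
  have hpos := topMass_pos hs
  by_cases hvs : insert v s ∈ X.level (insert v s).card
  · rw [Finset.card_insert_of_notMem hv, card_of_mem_level hs, add_comm] at hvs
    have hdisj : Disjoint {v} s := Finset.disjoint_singleton_left.2 hv
    have hmem : {v} ∈ (X.link s hs).level 1 := (mem_level_link hs).2 ⟨hdisj, hvs⟩
    have key := ((h i hi.le s hs).prob_le_and_sum_sq_le hγ (by omega) hmem).2
    rw [X.prob_link hs hdisj (Finset.card_singleton v)] at key
    have hdi : d - i = 2 := by omega
    have hinj : Set.InjOn (fun x => x \ s) ({x ∈ X.level (i + 1) | s ⊂ x ∧ v ∉ x} : Finset _) := by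
      intro x hx y hy hxy
      rw [← Finset.sdiff_union_of_subset (Finset.mem_filter.1 hx).2.1.subset,
        ← Finset.sdiff_union_of_subset (Finset.mem_filter.1 hy).2.1.subset]
      exact congrArg (· ∪ s) hxy
    have hterm : ∀ x ∈ ({x ∈ X.level (i + 1) | s ⊂ x ∧ v ∉ x} : Finset _),
        X.topMass (insert v x) ^ 2 / X.topMass x / X.topMass s =
        (X.link s hs).prob (x \ s ∪ {v}) ^ 2 / (2 * (X.link s hs).prob (x \ s)) := by
      intro x hx
      obtain ⟨hx, hsx, hvx⟩ := Finset.mem_filter.1 hx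
      have hc : (x \ s).card = 1 := by
        rw [Finset.card_sdiff_of_subset hsx.subset, card_of_mem_level hx, card_of_mem_level hs]
        omega
      have hd1 : Disjoint (x \ s) s := Finset.sdiff_disjoint
      have hvx' : v ∉ x \ s := fun h => hvx (Finset.mem_sdiff.1 h).1
      have hc2 : (x \ s ∪ {v}).card = 2 := by
        rw [Finset.union_singleton, Finset.card_insert_of_notMem hvx', hc]
      have hx' : x \ s ∪ {v} ∪ s = insert v x := by
        rw [Finset.union_right_comm, Finset.sdiff_union_of_subset hsx.subset,
          Finset.union_singleton]
      rw [X.prob_link hs hd1 hc, X.prob_link hs (Finset.disjoint_union_left.2 ⟨hd1, hdisj⟩) hc2,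
        Finset.sdiff_union_of_subset hsx.subset, hx', hdi]
      have h1 := topMass_pos hx
      norm_num
      field_simp
    have hsub : ({x ∈ X.level (i + 1) | s ⊂ x ∧ v ∉ x} : Finset _).image (fun x => x \ s) ⊆
        {u ∈ (X.link s hs).level 1 | u ≠ {v}} := by
      intro u hu
      obtain ⟨x, hx, rfl⟩ := Finset.mem_image.1 hu
      obtain ⟨hx, hsx, hvx⟩ := Finset.mem_filter.1 hx
      refine Finset.mem_filter.2 ⟨(mem_level_link hs).2 ⟨Finset.sdiff_disjoint, ?_⟩, fun he => ?_⟩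
      · rwa [Finset.sdiff_union_of_subset hsx.subset, add_comm]
      · have : v ∈ x \ s := he ▸ Finset.mem_singleton_self v
        exact hvx (Finset.mem_sdiff.1 this).1
    have hsum := Finset.sum_le_sum_of_subset_of_nonneg hsub fun u _ _ =>
      div_nonneg (sq_nonneg ((X.link s hs).prob (u ∪ {v})))
        (mul_nonneg zero_le_two ((X.link s hs).prob_nonneg u))
    rw [Finset.sum_image hinj, ← Finset.sum_congr rfl hterm, ← Finset.sum_div] at hsum
    have h2 := hsum.trans key
    rw [hdi, Finset.singleton_union, div_le_iff₀ hpos] at h2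
    refine h2.trans (le_of_eq ?_)
    norm_num
    field_simp
  · have : X.topMass (insert v s) = 0 := topMass_eq_zero hvs
    rw [this, mul_zero]
    refine (Finset.sum_eq_zero fun x hx => ?_).le
    obtain ⟨-, hsx, -⟩ := Finset.mem_filter.1 hx
    have h0 : X.topMass (insert v x) = 0 :=
      le_antisymm (this ▸ X.topMass_anti (Finset.insert_subset_insert v hsx.subset))
        (X.topMass_nonneg _)
    simp [h0]

/-! ### The inner product and adjointness. -/

theorem innerProd_comm (X : WeightedComplex V d) {k : ℕ} (f g : X.Cochain k) :
    X.innerProd f g = X.innerProd g f := by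
  simp only [innerProd, mul_comm (f _)]

theorem innerProd_add_left (X : WeightedComplex V d) {k : ℕ} (f g h : X.Cochain k) :
    X.innerProd (f + g) h = X.innerProd f h + X.innerProd g h := by
  simp only [innerProd, Pi.add_apply, add_mul, mul_add, Finset.sum_add_distrib]

theorem innerProd_smul_left (X : WeightedComplex V d) {k : ℕ} (c : ℝ) (f g : X.Cochain k) :
    X.innerProd (c • f) g = c * X.innerProd f g := by
  simp only [innerProd, Pi.smul_apply, smul_eq_mul, Finset.mul_sum]
  exact Finset.sum_congr rfl fun x _ => by ring

theorem innerProd_sub_left (X : WeightedComplex V d) {k : ℕ} (f g h : X.Cochain k) :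
    X.innerProd (f - g) h = X.innerProd f h - X.innerProd g h := by
  simp only [innerProd, Pi.sub_apply, sub_mul, mul_sub, Finset.sum_sub_distrib]

theorem innerProd_self_nonneg (X : WeightedComplex V d) {k : ℕ} (f : X.Cochain k) :
    0 ≤ X.innerProd f f :=
  Finset.sum_nonneg fun _ _ => mul_nonneg (X.prob_nonneg _) (mul_self_nonneg _)

theorem innerProd_sq_le (X : WeightedComplex V d) {k : ℕ} (f g : X.Cochain k) :
    X.innerProd f g ^ 2 ≤ X.innerProd f f * X.innerProd g g := by
  have h := Finset.sum_mul_sq_le_sq_mul_sq Finset.univ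
    (fun x : X.level k => √(X.prob x.1) * f x) (fun x => √(X.prob x.1) * g x)
  have h1 : ∀ x : X.level k, √(X.prob x.1) ^ 2 = X.prob x.1 :=
    fun x => Real.sq_sqrt (X.prob_nonneg _)
  have h2 : ∀ f g : X.Cochain k,
      X.innerProd f g = ∑ x : X.level k, √(X.prob x.1) * f x * (√(X.prob x.1) * g x) :=
    fun f g => Finset.sum_congr rfl fun x _ => by rw [mul_mul_mul_comm, ← sq, h1]
  simpa only [h2, sq (_ * _)] using h

theorem abs_innerProd_le (X : WeightedComplex V d) {k : ℕ} (f g : X.Cochain k) :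
    |X.innerProd f g| ≤ √(X.innerProd f f) * √(X.innerProd g g) := by
  rw [← Real.sqrt_mul (X.innerProd_self_nonneg f)]
  exact Real.abs_le_sqrt (X.innerProd_sq_le f g)

/-- Up and down operators are adjoint. -/
theorem innerProd_down_left (X : WeightedComplex V d) {k : ℕ} (f : X.Cochain (k + 1))
    (g : X.Cochain k) : X.innerProd (X.down k f) g = X.innerProd f (X.up k g) := by
  simp only [innerProd, down, up, LinearMap.coe_mk, AddHom.coe_mk, Finset.sum_filter,
    Finset.mul_sum, Finset.sum_mul]
  rw [Finset.sum_comm]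
  refine Finset.sum_congr rfl fun y _ => Finset.sum_congr rfl fun x _ => ?_
  have := (prob_pos x.2).ne'
  split_ifs
  · field_simp
  · simp

theorem down_one (X : WeightedComplex V d) {k : ℕ} (hk : k < d) : X.down k 1 = 1 := by
  funext x
  have h := X.prob_eq_sum hk x.2
  have hpos := prob_pos x.2
  simp only [down, LinearMap.coe_mk, AddHom.coe_mk, Pi.one_apply, mul_one]
  rw [← Finset.sum_div, Finset.sum_filter,
    Finset.sum_coe_sort (X.level (k + 1)) fun y => if x.1 ⊂ y then X.prob y else 0,
    ← Finset.sum_filter, ← mul_div_assoc, ← h, div_self hpos.ne']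

/-! ### Stars under the up and down operators. -/

/-- The indicator function of the `m`-faces that contain `τ`. -/
def starIndicator (X : WeightedComplex V d) (τ : Finset V) (m : ℕ) : X.Cochain m :=
  fun y => if τ ⊆ y.1 then 1 else 0

/-- What the down operator adds to the indicator function of the faces that contain `τ`. -/
noncomputable def starDefect (X : WeightedComplex V d) (τ : Finset V) (m : ℕ) : X.Cochain m :=
  X.down m (X.starIndicator τ (m + 1)) - X.starIndicator τ m

theorem starIndicator_empty (X : WeightedComplex V d) (m : ℕ) : X.starIndicator ∅ m = 1 := by
  funext y
  simp [starIndicator]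

theorem card_filter_level_ssubset {X : WeightedComplex V d} {m : ℕ} {y τ : Finset V}
    (hy : y ∈ X.level (m + 1)) (hτ : τ ⊆ y) :
    ({x ∈ X.level m | x ⊂ y ∧ τ ⊆ x} : Finset _).card = m + 1 - τ.card := by
  have h : ({x ∈ X.level m | x ⊂ y ∧ τ ⊆ x} : Finset _) = (y \ τ).image y.erase := by
    have hyc := card_of_mem_level hy
    ext x
    simp only [Finset.mem_filter, Finset.mem_image, Finset.mem_sdiff]
    constructor
    · rintro ⟨hx, hxy, hτx⟩
      obtain ⟨v, hv, hvy⟩ := Finset.ssubset_iff.1 hxy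
      have hvx : insert v x = y := Finset.eq_of_subset_of_card_le hvy (by
        rw [Finset.card_insert_of_notMem hv, hyc, card_of_mem_level hx])
      exact ⟨v, ⟨hvy (Finset.mem_insert_self _ _), fun h => hv (hτx h)⟩,
        by rw [← hvx, Finset.erase_insert hv]⟩
    · rintro ⟨v, ⟨hvy, hvτ⟩, rfl⟩
      have hc : (y.erase v).card = m := by rw [Finset.card_erase_of_mem hvy, hyc]; omega
      have := mem_level_of_subset hy (y.erase_subset v)
      rw [hc] at this
      exact ⟨this, Finset.erase_ssubset hvy, Finset.subset_erase.2 ⟨hτ, hvτ⟩⟩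
  rw [h, Finset.card_image_of_injOn, Finset.card_sdiff_of_subset hτ, card_of_mem_level hy]
  exact (Finset.erase_injOn y).mono fun v hv => (Finset.mem_sdiff.1 hv).1

/-- Of the `m + 1` facets of a face above `τ`, exactly `m + 1 - τ.card` still contain `τ`. The
maximum matters only below level `τ.card`, where both indicators vanish. -/
theorem up_starIndicator (X : WeightedComplex V d) (τ : Finset V) (m : ℕ) :
    X.up m (X.starIndicator τ m) =
      (1 - (τ.card : ℝ) / (max τ.card (m + 1) : ℕ)) • X.starIndicator τ (m + 1) := by
  funext y
  simp only [up, starIndicator, LinearMap.coe_mk, AddHom.coe_mk, Pi.smul_apply, smul_eq_mul]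
  rw [Finset.sum_filter, Finset.sum_coe_sort (X.level m)
      fun x => if x ⊂ y.1 then (if τ ⊆ x then (1 : ℝ) else 0) else 0]
  simp only [← ite_and]
  rw [← Finset.sum_filter, Finset.sum_const, nsmul_one]
  split_ifs with h
  · have hle : τ.card ≤ m + 1 := card_of_mem_level y.2 ▸ Finset.card_le_card h
    rw [card_filter_level_ssubset y.2 h, max_eq_right hle, Nat.cast_sub hle]
    push_cast
    have : (m : ℝ) + 1 ≠ 0 := by positivity
    field_simp
  · rw [Finset.filter_false_of_mem]
    · simp
    · rintro x - ⟨hxy, hτx⟩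
      exact h (hτx.trans hxy.subset)

theorem up_one (X : WeightedComplex V d) (k : ℕ) : X.up k 1 = 1 := by
  simpa [starIndicator_empty] using X.up_starIndicator ∅ k

/-- The up operator is a contraction. -/
theorem innerProd_up_up_le (X : WeightedComplex V d) {k : ℕ} (hk : k < d) (f : X.Cochain k) :
    X.innerProd (X.up k f) (X.up k f) ≤ X.innerProd f f := by
  -- Jensen's inequality for the average over the facets of `y`; their number is read off from
  -- `up_one`.
  have h1 : ∀ y, X.up k f y * X.up k f y ≤ X.up k (f * f) y := by
    intro y
    have hone := congrFun (X.up_one k) y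
    simp only [up, LinearMap.coe_mk, AddHom.coe_mk, Pi.one_apply, Pi.mul_apply,
      Finset.sum_const, nsmul_one] at hone ⊢
    have hsq := sq_sum_le_card_mul_sum_sq
      (s := {x ∈ (Finset.univ : Finset (X.level k)) | x.1 ⊂ y.1}) (f := f)
    have hk' : (0 : ℝ) < (k : ℝ) + 1 := by positivity
    rw [one_div, inv_mul_eq_one₀ hk'.ne'] at hone
    rw [← hone] at hsq
    simp only [sq] at hsq
    have hinv : (0 : ℝ) ≤ 1 / ((k : ℝ) + 1) := by positivity
    refine le_trans (le_of_eq (mul_mul_mul_comm _ _ _ _)) ((mul_le_mul_of_nonneg_left hsq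
      (mul_nonneg hinv hinv)).trans (le_of_eq ?_))
    field_simp
  calc X.innerProd (X.up k f) (X.up k f) ≤ X.innerProd 1 (X.up k (f * f)) := by
        refine Finset.sum_le_sum fun y _ => mul_le_mul_of_nonneg_left ?_ (X.prob_nonneg _)
        rw [Pi.one_apply, one_mul]
        exact h1 y
    _ = X.innerProd f f := by
        rw [← innerProd_down_left, X.down_one hk]
        simp [innerProd]

/-- The down operator is a contraction. -/
theorem innerProd_down_down_le (X : WeightedComplex V d) {k : ℕ} (hk : k < d)
    (f : X.Cochain (k + 1)) : X.innerProd (X.down k f) (X.down k f) ≤ X.innerProd f f := by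
  -- By adjointness the left side is `⟨D f, D f⟩ ^ 2`, and one factor cancels because the up
  -- operator contracts.
  have h1 := X.innerProd_sq_le f (X.up k (X.down k f))
  rw [← innerProd_down_left] at h1
  have h2 := X.innerProd_up_up_le hk (X.down k f)
  have h3 := X.innerProd_self_nonneg f
  have h4 := X.innerProd_self_nonneg (X.down k f)
  rcases h4.eq_or_lt with h5 | h5
  · rw [← h5]; exact h3
  · refine le_of_mul_le_mul_right ?_ h5
    rw [← sq]
    exact h1.trans (mul_le_mul_of_nonneg_left h2 h3)

theorem innerProd_one_starIndicator (X : WeightedComplex V d) (τ : Finset V) (m : ℕ) :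
    X.innerProd 1 (X.starIndicator τ m) =
      X.innerProd (X.starIndicator τ m) (X.starIndicator τ m) := by
  simp only [innerProd, starIndicator, Pi.one_apply]
  exact Finset.sum_congr rfl fun x _ => by split_ifs <;> simp

theorem innerProd_starIndicator_succ (X : WeightedComplex V d) (τ : Finset V) {m : ℕ}
    (hm : m < d) :
    X.innerProd (X.starIndicator τ m) (X.starIndicator τ m) =
      (1 - (τ.card : ℝ) / (max τ.card (m + 1) : ℕ)) *
        X.innerProd (X.starIndicator τ (m + 1)) (X.starIndicator τ (m + 1)) := by
  rw [← innerProd_one_starIndicator, ← innerProd_one_starIndicator, ← X.down_one hm,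
    innerProd_down_left, up_starIndicator, innerProd_comm, innerProd_smul_left, innerProd_comm]

theorem starDefect_of_subset (X : WeightedComplex V d) {τ : Finset V} {m : ℕ} (hm : m < d)
    {x : X.level m} (hx : τ ⊆ x.1) : X.starDefect τ m x = 0 := by
  have h : X.down m (X.starIndicator τ (m + 1)) x = X.down m 1 x := by
    simp only [down, LinearMap.coe_mk, AddHom.coe_mk]
    congr 1
    refine Finset.sum_congr rfl fun y hy => ?_
    rw [starIndicator, if_pos (hx.trans (Finset.mem_filter.1 hy).2.subset), Pi.one_apply]
  rw [starDefect, Pi.sub_apply, h, X.down_one hm, starIndicator, if_pos hx, Pi.one_apply, sub_self]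

/-- Only `x ∪ τ` can be an `(m + 1)`-face above both `x` and `τ`, so at most one term of the down
operator survives. -/
theorem starDefect_of_not_subset (X : WeightedComplex V d) {τ : Finset V} {m : ℕ}
    {x : X.level m} (hx : ¬ τ ⊆ x.1) :
    X.starDefect τ m x = if (x.1 ∪ τ).card = m + 1 then
      X.topMass (x.1 ∪ τ) / (((d : ℝ) - m) * X.topMass x.1) else 0 := by
  have hxc := card_of_mem_level x.2
  have hlt : x.1 ⊂ x.1 ∪ τ := Finset.ssubset_iff_subset_ne.2
    ⟨Finset.subset_union_left, fun h => hx (Finset.union_eq_left.1 h.symm)⟩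
  have heq : ∀ y ∈ X.level (m + 1), x.1 ⊂ y → τ ⊆ y → y = x.1 ∪ τ := by
    intro y hy hxy hτy
    refine (Finset.eq_of_subset_of_card_le (Finset.union_subset hxy.subset hτy) ?_).symm
    have := Finset.card_lt_card hlt
    rw [card_of_mem_level hy]
    omega
  rw [starDefect, Pi.sub_apply, starIndicator, if_neg hx, sub_zero]
  simp only [down, starIndicator, LinearMap.coe_mk, AddHom.coe_mk, mul_ite, mul_one, mul_zero,
    Finset.sum_filter]
  rw [Finset.sum_coe_sort (X.level (m + 1))
    fun y => if x.1 ⊂ y then (if τ ⊆ y then X.prob y / X.prob x.1 else 0) else 0]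
  by_cases hmem : x.1 ∪ τ ∈ X.level (m + 1)
  · rw [if_pos (card_of_mem_level hmem), Finset.sum_eq_single_of_mem _ hmem, if_pos hlt,
      if_pos Finset.subset_union_right, prob_div_prob x.2 hmem]
    intro y hy hne
    split_ifs with h1 h2
    · exact absurd (heq y hy h1 h2) hne
    · rfl
    · rfl
  · rw [Finset.sum_eq_zero, mul_zero]
    · split_ifs with hc
      · rw [topMass_eq_zero (hc ▸ hmem), zero_div]
      · rfl
    · intro y hy
      split_ifs with h1 h2
      · exact absurd (heq y hy h1 h2 ▸ hy) hmem
      · rfl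
      · rfl

/-- The supports are disjoint. This orthogonality is what turns an error of order `√γ` into one
linear in `γ`. -/
theorem innerProd_starDefect_starIndicator (X : WeightedComplex V d) (τ : Finset V) {m : ℕ}
    (hm : m < d) : X.innerProd (X.starDefect τ m) (X.starIndicator τ m) = 0 := by
  refine Finset.sum_eq_zero fun x _ => ?_
  by_cases h : τ ⊆ x.1
  · rw [X.starDefect_of_subset hm h]; simp
  · simp [starIndicator, h]

theorem starDefect_empty (X : WeightedComplex V d) {m : ℕ} (hm : m < d) :
    X.starDefect ∅ m = 0 :=
  funext fun x => X.starDefect_of_subset hm (Finset.empty_subset x.1)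

theorem starDefect_nonneg (X : WeightedComplex V d) (τ : Finset V) {m : ℕ} (hm : m < d)
    (x : X.level m) : 0 ≤ X.starDefect τ m x := by
  by_cases h : τ ⊆ x.1
  · rw [X.starDefect_of_subset hm h]
  · rw [X.starDefect_of_not_subset h]
    have h1 : (0 : ℝ) < (d : ℝ) - m := sub_pos.2 (by exact_mod_cast hm)
    have h2 := X.topMass_nonneg (x.1 ∪ τ)
    have h3 := X.topMass_nonneg x.1
    split_ifs <;> positivity

theorem starDefect_le_down (X : WeightedComplex V d) (τ : Finset V) (m : ℕ) (x : X.level m) :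
    X.starDefect τ m x ≤ X.down m (X.starIndicator τ (m + 1)) x := by
  rw [starDefect, Pi.sub_apply, sub_le_self_iff, starIndicator]
  split_ifs <;> norm_num

/-! ### The size of the defect. -/

theorem IsLocalSpectralExpander.starDefect_le {X : WeightedComplex V d} {γ : ℝ}
    (h : X.IsLocalSpectralExpander γ) (hγ : 0 ≤ γ) (τ : Finset V) {m : ℕ} (hm : m + 2 ≤ d)
    (x : X.level m) : X.starDefect τ m x ≤ γ := by
  by_cases hx : τ ⊆ x.1
  · rwa [X.starDefect_of_subset (by omega) hx]
  · rw [X.starDefect_of_not_subset hx]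
    have h1 : (0 : ℝ) < (d : ℝ) - m := sub_pos.2 (by exact_mod_cast (by omega : m < d))
    split_ifs with hc
    · rw [div_le_iff₀ (mul_pos h1 (topMass_pos x.2))]
      obtain ⟨v, hvτ, hvx⟩ := Finset.not_subset.1 hx
      refine le_trans (X.topMass_anti ?_) (h.topMass_insert_le hγ hm x.2 hvx)
      exact Finset.insert_subset (Finset.mem_union_right _ hvτ) Finset.subset_union_left
    · exact hγ

/-- One factor of the square is at most `γ` pointwise; the other is at most the down image of the
star, whose mean is the squared norm of the star one level higher. -/
theorem IsLocalSpectralExpander.innerProd_starDefect_le_of_lt {X : WeightedComplex V d} {γ : ℝ}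
    (h : X.IsLocalSpectralExpander γ) (hγ : 0 ≤ γ) (τ : Finset V) {m : ℕ} (hm : m + 2 ≤ d) :
    X.innerProd (X.starDefect τ m) (X.starDefect τ m) ≤
      γ * X.innerProd (X.starIndicator τ (m + 1)) (X.starIndicator τ (m + 1)) := by
  have h1 : X.innerProd (X.starIndicator τ (m + 1)) (X.starIndicator τ (m + 1)) =
      X.innerProd (X.down m (X.starIndicator τ (m + 1))) 1 := by
    rw [innerProd_down_left, up_one, innerProd_comm _ _ 1, innerProd_one_starIndicator]
  rw [h1, ← innerProd_smul_left]
  refine Finset.sum_le_sum fun x _ => mul_le_mul_of_nonneg_left ?_ (X.prob_nonneg _)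
  rw [Pi.one_apply, mul_one, Pi.smul_apply, smul_eq_mul]
  exact mul_le_mul (h.starDefect_le hγ τ hm x) (X.starDefect_le_down τ m x)
    (X.starDefect_nonneg τ (by omega) x) hγ

/-- Double counting. Such an `x` misses exactly one vertex `v` of `τ`. When `x ∪ τ` is a face,
exchanging a vertex of `x \ τ` for `v` gives `m + 1 - τ.card` faces `y ⊇ τ`. For fixed `y` and `v`,
the sum over `x` is a two-step return to `v` in the link of `y.erase v`, which has codimension two.
-/
theorem IsLocalSpectralExpander.sum_sq_topMass_union_le {m : ℕ} {X : WeightedComplex V (m + 1)}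
    {γ : ℝ} (h : X.IsLocalSpectralExpander γ) (hγ : 0 ≤ γ) (τ : Finset V) :
    ((m : ℝ) + 1 - τ.card) * ∑ x ∈ X.level m with ¬ τ ⊆ x ∧ (x ∪ τ).card = m + 1,
        X.topMass (x ∪ τ) ^ 2 / X.topMass x ≤
      (γ + γ ^ 2) * τ.card * ∑ y ∈ X.level m with τ ⊆ y, X.topMass y := by
  have h1 : ∀ y ∈ X.level m, τ ⊆ y → ∀ v ∈ τ,
      ∑ x ∈ X.level m with y.erase v ⊂ x ∧ v ∉ x, X.topMass (insert v x) ^ 2 / X.topMass x ≤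
        (γ + γ ^ 2) * X.topMass y := by
    intro y hy hτ v hv
    have hvy := hτ hv
    have hc := Finset.card_erase_of_mem hvy
    have hmem := mem_level_of_subset hy (y.erase_subset v)
    have hpos := Finset.card_pos.2 ⟨v, hvy⟩
    rw [card_of_mem_level hy] at hc hpos
    obtain ⟨j, rfl⟩ := Nat.exists_eq_add_of_lt hpos
    rw [hc] at hmem
    have key := h.sum_sq_topMass_insert_le hγ (by omega) hmem (Finset.notMem_erase v y)
    rw [Finset.insert_erase hvy] at key
    convert key using 4
    omega
  have h2 : ∀ x ∈ X.level m, ¬ τ ⊆ x → (x ∪ τ).card = m + 1 →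
      ((m : ℝ) + 1 - τ.card) * (X.topMass (x ∪ τ) ^ 2 / X.topMass x) ≤
      ∑ y ∈ X.level m with τ ⊆ y, ∑ v ∈ τ, if y.erase v ⊂ x ∧ v ∉ x then
        X.topMass (insert v x) ^ 2 / X.topMass x else 0 := by
    intro x hx hτ hc
    have hnn : ∀ v, 0 ≤ X.topMass (insert v x) ^ 2 / X.topMass x :=
      fun v => div_nonneg (sq_nonneg _) (X.topMass_nonneg _)
    by_cases hmem : x ∪ τ ∈ X.level (m + 1)
    · obtain ⟨v, hvτ, hvx⟩ := Finset.not_subset.1 hτ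
      have hxc := card_of_mem_level hx
      have hins : insert v x = x ∪ τ := Finset.eq_of_subset_of_card_le
        (Finset.insert_subset (Finset.mem_union_right _ hvτ) Finset.subset_union_left)
        (by rw [hc, Finset.card_insert_of_notMem hvx, hxc])
      have hcard : (x \ τ).card = m + 1 - τ.card := by
        rw [← hc, ← Finset.union_sdiff_right, Finset.card_sdiff_of_subset Finset.subset_union_right]
      have hτle : τ.card ≤ m + 1 := hc ▸ Finset.card_le_card Finset.subset_union_right
      have hinj : Set.InjOn (fun w => insert v (x.erase w)) (x \ τ : Finset V) := by
        intro a ha b hb hab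
        have ha' := (Finset.mem_sdiff.1 ha).1
        have hb' := (Finset.mem_sdiff.1 hb).1
        have hva : v ∉ x.erase a := fun h => hvx (Finset.mem_of_mem_erase h)
        have hvb : v ∉ x.erase b := fun h => hvx (Finset.mem_of_mem_erase h)
        have := congrArg (fun s => s.erase v) hab
        simp only [Finset.erase_insert hva, Finset.erase_insert hvb] at this
        exact Finset.erase_injOn x ha' hb' this
      have hsub : (x \ τ).image (fun w => insert v (x.erase w)) ⊆
          {y ∈ X.level m | τ ⊆ y} := by
        intro y hy
        obtain ⟨w, hw, rfl⟩ := Finset.mem_image.1 hy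
        obtain ⟨hwx, hwτ⟩ := Finset.mem_sdiff.1 hw
        have hvw : v ∉ x.erase w := fun h => hvx (Finset.mem_of_mem_erase h)
        have hsub : insert v (x.erase w) ⊆ x ∪ τ :=
          hins ▸ Finset.insert_subset_insert v (x.erase_subset w)
        have hc' : (insert v (x.erase w)).card = m := by
          rw [Finset.card_insert_of_notMem hvw, Finset.card_erase_of_mem hwx, hxc]
          have := Finset.card_pos.2 ⟨w, hwx⟩
          omega
        have hmem' := mem_level_of_subset hmem hsub
        rw [hc'] at hmem'
        refine Finset.mem_filter.2 ⟨hmem', fun a ha => ?_⟩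
        have : a ∈ insert v x := hins ▸ Finset.mem_union_right _ ha
        rcases Finset.mem_insert.1 this with rfl | hax
        · exact Finset.mem_insert_self _ _
        · refine Finset.mem_insert_of_mem (Finset.mem_erase.2 ⟨?_, hax⟩)
          rintro rfl
          exact hwτ ha
      refine le_trans ?_ (Finset.sum_le_sum_of_subset_of_nonneg hsub
        fun y _ _ => Finset.sum_nonneg fun v _ => ?_)
      · rw [Finset.sum_image hinj]
        have hterm : ∀ w ∈ x \ τ, X.topMass (x ∪ τ) ^ 2 / X.topMass x ≤
            ∑ u ∈ τ, if (insert v (x.erase w)).erase u ⊂ x ∧ u ∉ x then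
              X.topMass (insert u x) ^ 2 / X.topMass x else 0 := by
          intro w hw
          have hwx := (Finset.mem_sdiff.1 hw).1
          have hvw : v ∉ x.erase w := fun h => hvx (Finset.mem_of_mem_erase h)
          refine le_trans (le_of_eq ?_) (Finset.single_le_sum (fun u _ => ?_) hvτ)
          · rw [if_pos, hins]
            rw [Finset.erase_insert hvw]
            exact ⟨Finset.erase_ssubset hwx, hvx⟩
          · split_ifs
            exacts [hnn u, le_rfl]
        have := Finset.card_nsmul_le_sum _ _ _ hterm
        rwa [hcard, nsmul_eq_mul, Nat.cast_sub hτle, Nat.cast_add, Nat.cast_one] at this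
      · split_ifs
        exacts [hnn v, le_rfl]
    · have : X.topMass (x ∪ τ) = 0 := topMass_eq_zero (by rwa [hc])
      rw [this, zero_pow two_ne_zero, zero_div, mul_zero]
      refine Finset.sum_nonneg fun y _ => Finset.sum_nonneg fun v _ => ?_
      split_ifs
      exacts [hnn v, le_rfl]
  calc _ ≤ ∑ x ∈ X.level m, ∑ y ∈ X.level m with τ ⊆ y, ∑ v ∈ τ,
        (if y.erase v ⊂ x ∧ v ∉ x then X.topMass (insert v x) ^ 2 / X.topMass x else 0) := by
        rw [Finset.mul_sum]
        refine le_trans (Finset.sum_le_sum fun x hx => ?_)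
          (Finset.sum_le_sum_of_subset_of_nonneg (Finset.filter_subset _ _) fun x _ _ =>
            Finset.sum_nonneg fun y _ => Finset.sum_nonneg fun v _ => ?_)
        · obtain ⟨hx, hτ, hc⟩ := Finset.mem_filter.1 hx
          exact h2 x hx hτ hc
        · split_ifs
          exacts [div_nonneg (sq_nonneg _) (X.topMass_nonneg _), le_rfl]
    _ = ∑ y ∈ X.level m with τ ⊆ y, ∑ v ∈ τ, ∑ x ∈ X.level m with y.erase v ⊂ x ∧ v ∉ x,
          X.topMass (insert v x) ^ 2 / X.topMass x := by
        rw [Finset.sum_comm]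
        refine Finset.sum_congr rfl fun y _ => ?_
        rw [Finset.sum_comm]
        exact Finset.sum_congr rfl fun v _ => (Finset.sum_filter _ _).symm
    _ ≤ ∑ y ∈ X.level m with τ ⊆ y, ∑ v ∈ τ, (γ + γ ^ 2) * X.topMass y :=
        Finset.sum_le_sum fun y hy => Finset.sum_le_sum fun v hv =>
          h1 y (Finset.mem_filter.1 hy).1 (Finset.mem_filter.1 hy).2 v hv
    _ = _ := by
        simp only [Finset.sum_const, nsmul_eq_mul, Finset.mul_sum]
        exact Finset.sum_congr rfl fun y _ => by ring

theorem innerProd_starIndicator_self (X : WeightedComplex V d) (τ : Finset V) (m : ℕ) :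
    X.innerProd (X.starIndicator τ m) (X.starIndicator τ m) =
      ∑ y ∈ X.level m with τ ⊆ y, X.prob y := by
  rw [Finset.sum_filter, ← Finset.sum_coe_sort]
  simp only [innerProd, starIndicator]
  exact Finset.sum_congr rfl fun x _ => by split_ifs <;> simp

/-- Rewritten in top masses, this is the double count; the common factor `m + 1 - τ.card` is
positive because `τ.card ≤ m`, and the remaining factor `m + 1` on the left is dropped. -/
theorem IsLocalSpectralExpander.innerProd_starDefect_top_le {m : ℕ}
    {X : WeightedComplex V (m + 1)}
    {γ : ℝ} (h : X.IsLocalSpectralExpander γ) (hγ : 0 ≤ γ) {τ : Finset V} (hτ : τ.card ≤ m) :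
    X.innerProd (X.starDefect τ m) (X.starDefect τ m) ≤
      τ.card * (γ + γ ^ 2) *
        X.innerProd (X.starIndicator τ (m + 1)) (X.starIndicator τ (m + 1)) := by
  have key := h.sum_sq_topMass_union_le hγ τ
  have hstar := X.innerProd_starIndicator_succ τ (Nat.lt_succ_self m)
  have hnn := X.innerProd_self_nonneg (X.starIndicator τ (m + 1))
  set G := X.innerProd (X.starIndicator τ (m + 1)) (X.starIndicator τ (m + 1))
  have hprob : ∀ x ∈ X.level m, X.topMass x = ((m : ℝ) + 1) * X.prob x := by
    intro x hx
    rw [prob_of_mem_level hx, Nat.choose_succ_self_right]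
    push_cast
    field_simp
  have hdef : X.innerProd (X.starDefect τ m) (X.starDefect τ m) * ((m : ℝ) + 1) =
      ∑ x ∈ X.level m with ¬ τ ⊆ x ∧ (x ∪ τ).card = m + 1,
        X.topMass (x ∪ τ) ^ 2 / X.topMass x := by
    rw [Finset.sum_filter, ← Finset.sum_coe_sort, innerProd, Finset.sum_mul]
    refine Finset.sum_congr rfl fun x _ => ?_
    by_cases hx : τ ⊆ x.1
    · simp [X.starDefect_of_subset (Nat.lt_succ_self m) hx, hx]
    · rw [X.starDefect_of_not_subset hx]
      by_cases hc : (x.1 ∪ τ).card = m + 1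
      · have hpos := topMass_pos x.2
        have hx' := hprob x.1 x.2
        rw [if_pos hc, if_pos ⟨hx, hc⟩]
        push_cast
        rw [add_sub_cancel_left, one_mul, mul_right_comm, mul_comm (X.prob x.1), ← hx']
        field_simp
      · simp [hc]
  have hG : ∑ y ∈ X.level m with τ ⊆ y, X.topMass y = ((m : ℝ) + 1 - τ.card) * G := by
    rw [Finset.sum_congr rfl fun y hy => hprob y (Finset.mem_filter.1 hy).1, ← Finset.mul_sum,
      ← innerProd_starIndicator_self, hstar, max_eq_right (by omega)]
    push_cast
    field_simp
  have hpos : 0 < (m : ℝ) + 1 - τ.card := by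
    have : (τ.card : ℝ) ≤ m := by exact_mod_cast hτ
    linarith
  rw [hG, ← hdef, mul_left_comm ((γ + γ ^ 2) * (τ.card : ℝ)), mul_le_mul_iff_right₀ hpos] at key
  have h0 := X.innerProd_self_nonneg (X.starDefect τ m)
  have hm : (0 : ℝ) ≤ m := Nat.cast_nonneg m
  nlinarith

theorem IsLocalSpectralExpander.innerProd_starDefect_le {X : WeightedComplex V d} {γ : ℝ}
    (h : X.IsLocalSpectralExpander γ) (hγ : 0 ≤ γ) {τ : Finset V} (hτ : τ.card < d) {m : ℕ}
    (hm : m < d) :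
    X.innerProd (X.starDefect τ m) (X.starDefect τ m) ≤
      τ.card * (γ + γ ^ 2) *
        X.innerProd (X.starIndicator τ (m + 1)) (X.starIndicator τ (m + 1)) := by
  rcases Nat.lt_or_ge (m + 1) d with hm' | hm'
  · rcases τ.eq_empty_or_nonempty with rfl | hne
    · rw [X.starDefect_empty hm]
      simp [innerProd]
    · refine (h.innerProd_starDefect_le_of_lt hγ τ hm').trans
        (mul_le_mul_of_nonneg_right ?_ (X.innerProd_self_nonneg _))
      have : (1 : ℝ) ≤ τ.card := by exact_mod_cast Finset.card_pos.2 hne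
      nlinarith [sq_nonneg γ]
  · obtain rfl : d = m + 1 := by omega
    exact h.innerProd_starDefect_top_le hγ (by omega)

end WeightedComplex

end HDX

namespace HDX

open WeightedComplex

/-! ### Words and their level bookkeeping. -/

namespace UDWord

variable {V : Type*} [DecidableEq V] {d a b : ℕ}

theorem le_top : ∀ {b : ℕ} (w : UDWord a b), b ≤ w.top
  | _, nil => le_rfl
  | _, up _ => le_max_right _ _
  | _, down w => (Nat.le_succ _).trans w.le_top

/-- The surplus `height + b - a` is the number of up letters. -/
theorem le_height_add : ∀ {b : ℕ} (w : UDWord a b), a ≤ w.height + b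
  | _, nil => by simp [height]
  | _, up w => by have := w.le_height_add; simp only [height]; omega
  | _, down w => by have := w.le_height_add; simp only [height]; omega

theorem operator_one (X : WeightedComplex V d) :
    ∀ {b : ℕ} (w : UDWord a b), w.top ≤ d → w.operator X 1 = 1
  | _, nil, _ => rfl
  | _, @up _ b w, h => by
    rw [operator, LinearMap.comp_apply, w.operator_one X ((le_max_left _ _).trans h), X.up_one]
  | _, @down _ b w, h => by
    rw [operator, LinearMap.comp_apply, w.operator_one X h, X.down_one (w.le_top.trans h)]

end UDWord

/-- Up factors and eigenvalue factors are both ratios of consecutive binomial coefficients, so they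
telescope along a word. The product form also covers levels below `l`, where the coefficients
vanish. -/
theorem one_sub_div_max_mul_choose (l b : ℕ) :
    (1 - (l : ℝ) / (max l (b + 1) : ℕ)) * ((b + 1).choose l : ℝ) = b.choose l := by
  rcases Nat.lt_or_ge b l with h | h
  · rw [max_eq_left h, Nat.choose_eq_zero_of_lt h, div_self, sub_self, zero_mul, Nat.cast_zero]
    exact_mod_cast (by omega : l ≠ 0)
  · rw [max_eq_right (by omega)]
    have h1 := Nat.add_one_mul_choose_eq b l
    have h2 := Nat.choose_succ_right_eq (b + 1) l
    have h3 : ((b : ℝ) + 1) * b.choose l = ((b + 1).choose l) * ((b : ℝ) + 1 - l) := by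
      have h4 : (b + 1 - l : ℕ) = (b : ℝ) + 1 - l := by
        rw [Nat.cast_sub (by omega)]; push_cast; ring
      rw [← h4]
      exact_mod_cast h1.trans h2
    push_cast
    field_simp
    linarith

namespace WeightedComplex

variable {V : Type*} [DecidableEq V] {d : ℕ}

/-! ### Functions near a multiple of a star. -/

/-- The function `ψ` is, up to an error of norm at most `K`, the multiple `c` of the indicator
function of the faces that contain `τ`, and this multiple has squared norm at most `G`. -/
def IsNearStar (X : WeightedComplex V d) (τ : Finset V) (G K : ℝ) {b : ℕ} (c : ℝ)
    (ψ : X.Cochain b) : Prop :=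
  c ^ 2 * X.innerProd (X.starIndicator τ b) (X.starIndicator τ b) ≤ G ∧
    ∀ φ : X.Cochain b, |X.innerProd (ψ - c • X.starIndicator τ b) φ| ≤ K * √(X.innerProd φ φ)

theorem sq_mul_innerProd_starIndicator_up_le (X : WeightedComplex V d) (τ : Finset V) {b : ℕ}
    (hb : b < d) {G c : ℝ}
    (h : c ^ 2 * X.innerProd (X.starIndicator τ b) (X.starIndicator τ b) ≤ G) :
    (c * (1 - (τ.card : ℝ) / (max τ.card (b + 1) : ℕ))) ^ 2 *
      X.innerProd (X.starIndicator τ (b + 1)) (X.starIndicator τ (b + 1)) ≤ G := by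
  have h1 := X.innerProd_up_up_le hb (X.starIndicator τ b)
  rw [up_starIndicator, innerProd_smul_left, innerProd_comm, innerProd_smul_left] at h1
  refine le_trans (le_of_eq ?_) ((mul_le_mul_of_nonneg_left h1 (sq_nonneg c)).trans h)
  ring

theorem innerProd_starIndicator_le_succ (X : WeightedComplex V d) (τ : Finset V) {b : ℕ}
    (hb : b < d) :
    X.innerProd (X.starIndicator τ b) (X.starIndicator τ b) ≤
      X.innerProd (X.starIndicator τ (b + 1)) (X.starIndicator τ (b + 1)) := by
  rw [X.innerProd_starIndicator_succ τ hb]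
  refine mul_le_of_le_one_left (X.innerProd_self_nonneg _) (sub_le_self _ ?_)
  positivity

theorem sqrt_innerProd_smul_starDefect_le (X : WeightedComplex V d) {τ : Finset V} {b : ℕ}
    {G ε c : ℝ} (hε : 0 ≤ ε)
    (h : c ^ 2 * X.innerProd (X.starIndicator τ (b + 1)) (X.starIndicator τ (b + 1)) ≤ G)
    (hdef : X.innerProd (X.starDefect τ b) (X.starDefect τ b) ≤
      ε * X.innerProd (X.starIndicator τ (b + 1)) (X.starIndicator τ (b + 1))) :
    √(X.innerProd (c • X.starDefect τ b) (c • X.starDefect τ b)) ≤ √(ε * G) := by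
  refine Real.sqrt_le_sqrt ?_
  rw [innerProd_smul_left, innerProd_comm, innerProd_smul_left]
  nlinarith [mul_le_mul_of_nonneg_left hdef (sq_nonneg c), mul_le_mul_of_nonneg_left h hε]

/-- The up operator contracts the error and is exact on the star, so it costs nothing. -/
theorem IsNearStar.up {X : WeightedComplex V d} {τ : Finset V} {G K c : ℝ} (hK : 0 ≤ K) {b : ℕ}
    (hb : b < d) {ψ : X.Cochain b} (h : X.IsNearStar τ G K c ψ) :
    X.IsNearStar τ G K (c * (1 - (τ.card : ℝ) / (max τ.card (b + 1) : ℕ))) (X.up b ψ) := by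
  refine ⟨X.sq_mul_innerProd_starIndicator_up_le τ hb h.1, fun φ => ?_⟩
  have h1 : X.up b ψ - (c * (1 - (τ.card : ℝ) / (max τ.card (b + 1) : ℕ))) •
      X.starIndicator τ (b + 1) = X.up b (ψ - c • X.starIndicator τ b) := by
    rw [map_sub, map_smul, up_starIndicator, smul_smul]
  rw [h1, innerProd_comm, ← innerProd_down_left, innerProd_comm]
  exact (h.2 _).trans (mul_le_mul_of_nonneg_left
    (Real.sqrt_le_sqrt (X.innerProd_down_down_le hb φ)) hK)

/-- The down operator contracts the old error and adds one defect. -/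
theorem IsNearStar.down {X : WeightedComplex V d} {τ : Finset V} {G K c ε : ℝ} (hK : 0 ≤ K)
    (hε : 0 ≤ ε) {b : ℕ} (hb : b < d)
    (hdef : X.innerProd (X.starDefect τ b) (X.starDefect τ b) ≤
      ε * X.innerProd (X.starIndicator τ (b + 1)) (X.starIndicator τ (b + 1)))
    {ψ : X.Cochain (b + 1)} (h : X.IsNearStar τ G K c ψ) :
    X.IsNearStar τ G (K + √(ε * G)) c (X.down b ψ) := by
  refine ⟨(mul_le_mul_of_nonneg_left (X.innerProd_starIndicator_le_succ τ hb)
    (sq_nonneg c)).trans h.1, fun φ => ?_⟩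
  have h1 : X.down b ψ - c • X.starIndicator τ b =
      X.down b (ψ - c • X.starIndicator τ (b + 1)) + c • X.starDefect τ b := by
    rw [map_sub, map_smul, starDefect, smul_sub]
    abel
  rw [h1, innerProd_add_left, innerProd_down_left, add_mul]
  refine (abs_add_le _ _).trans (add_le_add ?_ ?_)
  · exact (h.2 _).trans (mul_le_mul_of_nonneg_left
      (Real.sqrt_le_sqrt (X.innerProd_up_up_le hb φ)) hK)
  · exact (X.abs_innerProd_le _ _).trans (mul_le_mul_of_nonneg_right
      (X.sqrt_innerProd_smul_starDefect_le hε h.1 hdef) (Real.sqrt_nonneg _))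

end WeightedComplex

namespace UDWord

variable {V : Type*} [DecidableEq V] {d : ℕ}

/-! ### Pure walks applied to a star. -/

/-- A word maps the indicator function of the `k`-faces that contain `τ` to a multiple of such an
indicator function, up to an error that is nearly orthogonal to functions near such multiples. -/
theorem exists_abs_innerProd_operator_sub_le (X : WeightedComplex V d) {τ : Finset V} {k : ℕ}
    {ε : ℝ} (hε : 0 ≤ ε)
    (hdef : ∀ b, b < d → X.innerProd (X.starDefect τ b) (X.starDefect τ b) ≤
      ε * X.innerProd (X.starIndicator τ (b + 1)) (X.starIndicator τ (b + 1)))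
    {G : ℝ} (hG : G = X.innerProd (X.starIndicator τ k) (X.starIndicator τ k)) :
    ∀ {b : ℕ} (w : UDWord k b), w.top ≤ d → ∃ a : ℝ,
      a ^ 2 * X.innerProd (X.starIndicator τ b) (X.starIndicator τ b) ≤ G ∧
      a * (b.choose τ.card : ℝ) = w.approxEigenvalue τ.card * (k.choose τ.card : ℝ) ∧
      ∀ (N : ℕ) (c : ℝ) (ψ : X.Cochain b), X.IsNearStar τ G (N * √(ε * G)) c ψ →
        |X.innerProd (w.operator X (X.starIndicator τ k) - a • X.starIndicator τ b) ψ| ≤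
          w.height * (N + ((w.height : ℝ) + b - k)) * (ε * G)
  | _, nil, _ => by
    refine ⟨1, by simp [hG], by simp [approxEigenvalue], fun N c ψ _ => ?_⟩
    simp [operator, height, innerProd]
  -- The letter becomes a down operator on `ψ`, which raises `N` by one; the count `height + b - k`
  -- of up letters for the shorter word is lower by one, so the bound is unchanged.
  | _, @up _ b w, h => by
    obtain ⟨a, ha, hac, hψ⟩ := w.exists_abs_innerProd_operator_sub_le X hε hdef hG
      ((le_max_left _ _).trans h)
    have hb : b < d := (le_max_right w.top (b + 1)).trans h
    refine ⟨_, X.sq_mul_innerProd_starIndicator_up_le τ hb ha, ?_, fun N c ψ hN => ?_⟩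
    · rw [mul_assoc, one_sub_div_max_mul_choose, hac, approxEigenvalue]
    · have hK : 0 ≤ N * √(ε * G) := by positivity
      have h2 := hN.down hK hε hb (hdef b hb)
      rw [← add_one_mul, ← Nat.cast_add_one] at h2
      have h3 := hψ _ _ _ h2
      rw [innerProd_comm, innerProd_down_left, innerProd_comm, map_sub, map_smul,
        up_starIndicator, smul_smul] at h3
      refine h3.trans (le_of_eq ?_)
      simp only [height]
      push_cast
      ring
  -- The letter becomes an up operator on `ψ`, at no cost, but leaves a new defect to pair with `ψ`.
  | _, @down _ b w, h => by
    obtain ⟨a, ha, hac, hψ⟩ := w.exists_abs_innerProd_operator_sub_le X hε hdef hG h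
    have hb : b < d := w.le_top.trans h
    refine ⟨a, (mul_le_mul_of_nonneg_left (X.innerProd_starIndicator_le_succ τ hb)
      (sq_nonneg a)).trans ha, ?_, fun N c ψ hN => ?_⟩
    · rw [approxEigenvalue, mul_right_comm, ← hac, ← one_sub_div_max_mul_choose]
      ring
    · have hG0 : 0 ≤ G := hG ▸ X.innerProd_self_nonneg _
      have hK : 0 ≤ N * √(ε * G) := by positivity
      have h3 := hψ _ _ _ (hN.up hK hb)
      rw [← innerProd_down_left, map_sub, map_smul] at h3
      -- The defect is orthogonal to the star and sees only the deviation of `ψ` from it, so two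
      -- factors `√(ε * G)` multiply.
      have h4 : |X.innerProd (a • X.starDefect τ b) ψ| ≤ N * (ε * G) := by
        have h5 : X.innerProd (a • X.starDefect τ b) ψ =
            X.innerProd (ψ - c • X.starIndicator τ b) (a • X.starDefect τ b) := by
          rw [innerProd_sub_left, innerProd_smul_left X c, innerProd_comm X (X.starIndicator τ b),
            innerProd_smul_left X a (X.starDefect τ b) (X.starIndicator τ b),
            X.innerProd_starDefect_starIndicator τ hb, innerProd_comm]
          ring
        rw [h5]
        refine (hN.2 _).trans ((mul_le_mul_of_nonneg_left
          (X.sqrt_innerProd_smul_starDefect_le hε ha (hdef b hb)) hK).trans (le_of_eq ?_))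
        rw [mul_assoc, Real.mul_self_sqrt (by positivity)]
      have h6 : (w.down.operator X) (X.starIndicator τ k) - a • X.starIndicator τ b =
          (X.down b (w.operator X (X.starIndicator τ k)) -
            a • X.down b (X.starIndicator τ (b + 1))) + a • X.starDefect τ b := by
        rw [operator, LinearMap.comp_apply, starDefect, smul_sub]
        abel
      rw [h6, innerProd_add_left]
      refine (abs_add_le _ _).trans ((add_le_add h3 h4).trans ?_)
      -- The number of up letters is non-negative, so raising the height by one leaves room for the
      -- new term `N * (ε * G)`.
      have h7 : (k : ℝ) ≤ w.height + (b + 1 : ℕ) := by exact_mod_cast w.le_height_add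
      have h8 : 0 ≤ ((w.height : ℝ) + (b + 1 : ℕ) - k) * (ε * G) :=
        mul_nonneg (by linarith) (by positivity)
      simp only [height]
      push_cast at h8 ⊢
      linarith

theorem abs_innerProd_operator_sub_le (X : WeightedComplex V d) {τ : Finset V} {k : ℕ}
    {ε : ℝ} (hε : 0 ≤ ε) (hτ : τ.card ≤ k)
    (hdef : ∀ b, b < d → X.innerProd (X.starDefect τ b) (X.starDefect τ b) ≤
      ε * X.innerProd (X.starIndicator τ (b + 1)) (X.starIndicator τ (b + 1)))
    (w : UDWord k k) (hw : w.top ≤ d) :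
    |X.innerProd (w.operator X (X.starIndicator τ k)) (X.starIndicator τ k) -
        w.approxEigenvalue τ.card * X.innerProd (X.starIndicator τ k) (X.starIndicator τ k)| ≤
      (w.height : ℝ) ^ 2 *
        (ε * X.innerProd (X.starIndicator τ k) (X.starIndicator τ k)) := by
  obtain ⟨a, -, hac, h⟩ := w.exists_abs_innerProd_operator_sub_le X hε hdef rfl hw
  have hne : (k.choose τ.card : ℝ) ≠ 0 := by exact_mod_cast (Nat.choose_pos hτ).ne'
  have ha := mul_right_cancel₀ hne hac
  -- The star is near itself without error, hence `N = 0`; on returning to level `k` the up letters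
  -- number `height`, which makes the coefficient its square.
  have h1 := h 0 1 (X.starIndicator τ k) ⟨by simp, fun φ => by simp [innerProd]⟩
  rw [innerProd_sub_left, innerProd_smul_left, ha] at h1
  refine h1.trans (le_of_eq ?_)
  push_cast
  ring

end UDWord

/-! ### Affine combinations and expansion. -/

namespace WalkCombination

variable {V : Type*} [DecidableEq V] {d k : ℕ}

theorem operator_apply (M : WalkCombination k) (X : WeightedComplex V d) (f : X.Cochain k) :
    M.operator X f = M.sum fun Y α => α • Y.operator X f := by
  simp [operator, Finsupp.sum, LinearMap.sum_apply]

theorem IsHDWalk.operator_one {M : WalkCombination k} {X : WeightedComplex V d}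
    (h : M.IsHDWalk X) : M.operator X 1 = 1 := by
  rw [operator_apply, Finsupp.sum, Finset.sum_congr rfl fun Y hY => by
    rw [Y.operator_one X (h.top_le Y hY)], ← Finset.sum_smul]
  have := h.affine
  rw [Finsupp.sum] at this
  rw [this, one_smul]

theorem abs_innerProd_operator_sub_le {M : WalkCombination k} {X : WeightedComplex V d}
    (h : ∀ Y ∈ M.support, Y.top ≤ d) {τ : Finset V} {ε : ℝ} (hε : 0 ≤ ε) (hτ : τ.card ≤ k)
    (hdef : ∀ b, b < d → X.innerProd (X.starDefect τ b) (X.starDefect τ b) ≤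
      ε * X.innerProd (X.starIndicator τ (b + 1)) (X.starIndicator τ (b + 1))) :
    |X.innerProd (M.operator X (X.starIndicator τ k)) (X.starIndicator τ k) -
        M.approxEigenvalue τ.card * X.innerProd (X.starIndicator τ k) (X.starIndicator τ k)| ≤
      M.weight * (M.height : ℝ) ^ 2 *
        (ε * X.innerProd (X.starIndicator τ k) (X.starIndicator τ k)) := by
  set G := X.innerProd (X.starIndicator τ k) (X.starIndicator τ k) with hG
  have hG0 : 0 ≤ G := X.innerProd_self_nonneg _
  have h1 : X.innerProd (M.operator X (X.starIndicator τ k)) (X.starIndicator τ k) =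
      ∑ Y ∈ M.support,
        M Y * X.innerProd (Y.operator X (X.starIndicator τ k)) (X.starIndicator τ k) := by
    classical
    rw [operator_apply, Finsupp.sum]
    induction M.support using Finset.induction_on with
    | empty => simp [innerProd]
    | insert Y s hY ih =>
      rw [Finset.sum_insert hY, Finset.sum_insert hY, innerProd_add_left, ih, innerProd_smul_left]
  rw [h1, approxEigenvalue, weight, Finsupp.sum, Finsupp.sum, Finset.sum_mul, Finset.sum_mul,
    Finset.sum_mul, ← Finset.sum_sub_distrib]
  refine (Finset.abs_sum_le_sum_abs _ _).trans (Finset.sum_le_sum fun Y hY => ?_)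
  rw [mul_assoc (M Y), ← mul_sub, abs_mul, mul_assoc |M Y|]
  refine mul_le_mul_of_nonneg_left ?_ (abs_nonneg _)
  refine (Y.abs_innerProd_operator_sub_le X hε hτ hdef (h Y hY)).trans
    (mul_le_mul_of_nonneg_right ?_ (mul_nonneg hε hG0))
  have : Y.height ≤ M.height := Finset.le_sup (f := UDWord.height) hY
  gcongr

end WalkCombination

namespace WeightedComplex

variable {V : Type*} [DecidableEq V] {d : ℕ}

theorem innerProd_starIndicator_pos {X : WeightedComplex V d} {i k : ℕ} {τ : Finset V}
    (hτ : τ ∈ X.level i) (hik : i ≤ k) (hk : k ≤ d) :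
    0 < X.innerProd (X.starIndicator τ k) (X.starIndicator τ k) := by
  obtain ⟨t, ht, hτt, hi⟩ := mem_level.1 hτ
  obtain ⟨y, hτy, hyt, hy⟩ := Finset.exists_subsuperset_card_eq hτt (hi.trans_le hik)
    (by rwa [X.card_eq t ht])
  rw [innerProd_starIndicator_self]
  exact Finset.sum_pos (fun y hy => prob_pos (Finset.mem_filter.1 hy).1)
    ⟨y, Finset.mem_filter.2 ⟨mem_level.2 ⟨t, ht, hyt, hy⟩, hτy⟩⟩

/-- As `M` fixes constants, the weights of leaving and of staying in the star add up to one at each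
face. -/
theorem expansion_linkFaces (X : WeightedComplex V d) {k : ℕ}
    {M : X.Cochain k →ₗ[ℝ] X.Cochain k} (hM : M 1 = 1) {τ : Finset V}
    (hpos : 0 < X.innerProd (X.starIndicator τ k) (X.starIndicator τ k)) :
    X.expansion M (X.linkFaces k τ) =
      1 - X.innerProd (M (X.starIndicator τ k)) (X.starIndicator τ k) /
        X.innerProd (X.starIndicator τ k) (X.starIndicator τ k) := by
  have h1 : ∀ v, ∑ y ∈ (X.linkFaces k τ)ᶜ, X.transition M v y = 1 - M (X.starIndicator τ k) v := by
    intro v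
    have h2 : ∑ y ∈ (X.linkFaces k τ)ᶜ, (Pi.single y 1 : X.Cochain k) =
        1 - X.starIndicator τ k := by
      funext x
      rw [Finset.sum_apply]
      simp only [Pi.single_apply, Finset.sum_ite_eq, Finset.mem_compl, linkFaces,
        Finset.mem_filter, Finset.mem_univ, true_and, Pi.sub_apply, Pi.one_apply, starIndicator]
      split_ifs <;> simp_all
    simp only [transition]
    rw [← Finset.sum_apply, ← map_sum, h2, map_sub, hM, Pi.sub_apply, Pi.one_apply]
  have h3 : ∑ v ∈ X.linkFaces k τ, X.prob v.1 =
      X.innerProd (X.starIndicator τ k) (X.starIndicator τ k) := by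
    rw [linkFaces, Finset.sum_filter]
    refine Finset.sum_congr rfl fun v _ => ?_
    simp only [starIndicator]
    split_ifs <;> simp
  have h4 : ∑ v ∈ X.linkFaces k τ, X.prob v.1 * (1 - M (X.starIndicator τ k) v) =
      X.innerProd (X.starIndicator τ k) (X.starIndicator τ k) -
        X.innerProd (M (X.starIndicator τ k)) (X.starIndicator τ k) := by
    rw [← innerProd_sub_left, linkFaces, Finset.sum_filter]
    refine Finset.sum_congr rfl fun v _ => ?_
    simp only [Pi.sub_apply, starIndicator]
    split_ifs <;> simp
  simp only [expansion, h1]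
  rw [h3, h4, sub_div, div_self hpos.ne']

end WeightedComplex

theorem two_mul_le_four_pow (k : ℕ) : 2 * k ≤ 4 ^ k := by
  induction k with
  | zero => simp
  | succ k ih =>
    have := Nat.one_le_pow k 4 (by norm_num)
    rw [pow_succ]
    omega

end HDX

theorem mainTheorem3 :
    ∃ C₁ C₂ : ℝ, 0 < C₁ ∧ 0 < C₂ ∧
      ∀ (n d k : ℕ) (γ : ℝ) (X : HDX.WeightedComplex (Fin n) d) (M : HDX.WalkCombination k),
        k < d → 0 ≤ γ → γ ≤ (2 : ℝ) ^ (-(C₁ * (k : ℝ))) →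
        X.IsLocalSpectralExpander γ → M.IsHDWalk X → M.IsComplete →
        ∀ i : ℕ, i ≤ k → ∀ τ ∈ X.level i,
          |X.expansion (M.operator X) (X.linkFaces k τ) - (1 - M.approxEigenvalue i)| ≤
            M.weight * (M.height : ℝ) ^ 2 * (2 : ℝ) ^ (C₂ * (k : ℝ)) * γ := by
  -- Any positive `C₁` would do, since it only has to force `γ ≤ 1`. The factor that arises is `2 *
  -- k`, which `2 ^ (2 * k) = 4 ^ k` dominates.
  refine ⟨1, 2, one_pos, two_pos, ?_⟩
  intro n d k γ X M hk hγ hγ1 hX hM _ i hi τ hτ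
  obtain rfl := HDX.WeightedComplex.card_of_mem_level hτ
  have hG := HDX.WeightedComplex.innerProd_starIndicator_pos hτ hi hk.le
  have hε : 0 ≤ (τ.card : ℝ) * (γ + γ ^ 2) := by positivity
  have key := HDX.WalkCombination.abs_innerProd_operator_sub_le hM.top_le hε hi
    fun b hb => hX.innerProd_starDefect_le hγ (hi.trans_lt hk) hb
  rw [X.expansion_linkFaces hM.operator_one hG, sub_sub_sub_cancel_left, abs_sub_comm,
    div_sub' hG.ne', abs_div, abs_of_pos hG, div_le_iff₀ hG, mul_comm (X.innerProd _ _)]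
  refine key.trans ?_
  have hγ2 : γ ≤ 1 := hγ1.trans (Real.rpow_le_one_of_one_le_of_nonpos one_le_two (by simp))
  have hpow : (2 : ℝ) ^ (2 * (k : ℝ)) = 4 ^ k := by
    rw [Real.rpow_mul zero_le_two, Real.rpow_natCast]
    norm_num
  have h1 : (τ.card : ℝ) * (γ + γ ^ 2) ≤ 4 ^ k * γ := by
    have h2 : 2 * (k : ℝ) ≤ 4 ^ k := by exact_mod_cast HDX.two_mul_le_four_pow k
    have h3 : (τ.card : ℝ) ≤ k := by exact_mod_cast hi
    calc (τ.card : ℝ) * (γ + γ ^ 2) ≤ k * (2 * γ) :=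
          mul_le_mul h3 (by nlinarith) (by positivity) (Nat.cast_nonneg k)
      _ = 2 * k * γ := by ring
      _ ≤ 4 ^ k * γ := mul_le_mul_of_nonneg_right h2 hγ
  have hw : 0 ≤ M.weight := Finset.sum_nonneg fun _ _ => abs_nonneg _
  rw [hpow, ← mul_assoc, mul_assoc (M.weight * _) _ γ]
  gcongr
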